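/- Let $M$ and $N$ be smooth manifolds modeled on real Banach spaces $\mathbb{E}$ and $\mathbb{E}'$ and let $k\ge 1$. Let $T^kM$ be the set of classes $[\gamma,x]_k$ of smooth curves $\gamma:(-\epsilon,\epsilon)\to M$ with $\gamma(0)=x$, where two curves through $x$ are identified if their derivatives at $0$ of orders $1,\dots,k$ (read in charts) agree; let $\pi^k_M([\gamma,x]_k)=x$, and for a smooth map $g:M\to N$ let $T^kg([\gamma,x]_k)=[g\circ\gamma,g(x)]_k$. A linear connection $\nabla$ on $M$ is given by its connection map $K:TTM\to TM$: a smooth vector bundle morphism over $TM\to M$ with $K\circ J=(\pi_M)_*$, where $J$ is the vertical endomorphism, locally $J(x,\xi;y,\eta)=(x,\xi;0,y)$, and which also commutes with fibrewise scalar multiplication of $TM$. In a chart $(U,\phi)$ it reads $K(x,\xi;y,\eta)=(x,\eta+\Gamma_\phi(x,\xi)y)$ with $\Gamma_\phi$ linear in $\xi$ and $y$. Connections $\nabla_M$, $\nabla_N$ are $g$-related if $K_N\circ TTg=Tg\circ K_M$. For $u=(x,\xi_1,\dots,\xi_k)$ put $\overset{1}{M}_\phi(u)y=\Gamma_\phi(x,\xi_1)y$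 and, for $2\le i\le k$, $$\overset{i}{M}_\phi(u)y=\frac1i\Big(\sum_{j=1}^{i}\partial_j\overset{i-1}{M}_\phi(x,\xi_1,\dots,\xi_{i-1})(y,j\xi_j)+\overset{1}{M}_\phi(u)\big[\overset{i-1}{M}_\phi(u)y\big]\Big),$$ where $\partial_j$ is the partial derivative in the $j$-th of the variables $x,\xi_1,\dots,\xi_{i-1}$. With $\gamma_\phi=\phi\circ\gamma$ and $u=(\gamma_\phi(0),\gamma_\phi'(0),\dots,\frac1{k!}\gamma_\phi^{(k)}(0))$, define $\Phi^k_\phi:(\pi^k_M)^{-1}(U)\to\phi(U)\times\mathbb{E}^k$ by $[\gamma,x]_k\mapsto(\phi(x),z^1,\dots,z^k)$, where $$z^i=\frac1i\Big(\frac{\gamma_\phi^{(i)}(0)}{(i-1)!}+\sum_{j=1}^{i-1}\overset{j}{M}_\phi(u)\frac{\gamma_\phi^{(i-j)}(0)}{(i-j-1)!}\Big).$$ Let $g:M\to N$ be a diffeomorphism and let $\nabla_M$, $\nabla_N$ be $g$-related linear connections. Then the trivializations $\Phi^k_\phi$ determined by $\nabla_M$ and by $\nabla_N$ define smooth vector bundle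 structures on $\pi^k_M:T^kM\to M$ and $\pi^k_N:T^kN\to N$, with fibres $\mathbb{E}^k$ and $(\mathbb{E}')^k$, and $(T^kg,g)$ is a vector bundle isomorphism between them. In particular, if $M=N$ and $\nabla$, $\nabla'$ are linear connections on $M$ that are $g$-related for a diffeomorphism $g:M\to M$, then the vector bundle structures on $T^kM$ determined by $\nabla$ and by $\nabla'$ are isomorphic by an isomorphism covering $g$. -/

import Mathlib

open Set Filter Topology
open scoped Manifold ContDiff

noncomputable section

namespace HigherOrderTangent

universe u v w

/-! ### Jets of curves and the tangent bundle of order `k` -/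

section Jets

/-- Two smooth curves with the same `k`-jet at `0` are sent by a smooth map to curves with the same
`k`-jet at `0`. -/
theorem jet_comp {G : Type w} [NormedAddCommGroup G] [NormedSpace ℝ G] (k : ℕ) :
    ∀ {E : Type u} [NormedAddCommGroup E] [NormedSpace ℝ E] (f : E → G) (a b : ℝ → E),
      ContDiffAt ℝ ∞ f (a 0) → ContDiffAt ℝ ∞ a 0 → ContDiffAt ℝ ∞ b 0 →
      (∀ j ≤ k, iteratedDeriv j a 0 = iteratedDeriv j b 0) →
      ∀ j ≤ k, iteratedDeriv j (f ∘ a) 0 = iteratedDeriv j (f ∘ b) 0 := by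
  induction k with
  | zero =>
    intro E _ _ f a b _ _ _ h j hj
    have h0 := h 0 le_rfl
    obtain rfl : j = 0 := by omega
    simp only [iteratedDeriv_zero] at h0 ⊢
    simp [h0]
  | succ k ih =>
    intro E _ _ f a b hf ha hb h j hj
    have h0 : a 0 = b 0 := by simpa using h 0 (Nat.zero_le _)
    rcases j with _ | j
    · simp [h0]
    have key : ∀ c : ℝ → E, ContDiffAt ℝ ∞ c 0 → ContDiffAt ℝ ∞ f (c 0) →
        deriv (f ∘ c) =ᶠ[𝓝 0]
          ((fun p : E × E => fderiv ℝ f p.1 p.2) ∘ fun t => (c t, deriv c t)) := by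
      intro c hc hfc
      have h1 : ∀ᶠ t in 𝓝 (0 : ℝ), ContDiffAt ℝ 1 c t :=
        (hc.of_le (by exact_mod_cast le_top)).eventually (by simp)
      have h2 : ∀ᶠ x in 𝓝 (c 0), ContDiffAt ℝ 1 f x :=
        (hfc.of_le (by exact_mod_cast le_top)).eventually (by simp)
      filter_upwards [h1, hc.continuousAt.eventually h2] with t ht1 ht2
      exact fderiv_comp_deriv t (ht2.differentiableAt (by simp)) (ht1.differentiableAt (by simp))
    have hder : ∀ c : ℝ → E, ContDiffAt ℝ ∞ c 0 → ContDiffAt ℝ ∞ (deriv c) 0 := by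
      intro c hc
      have : ContDiffAt ℝ ∞ (fun t => fderiv ℝ c t 1) 0 :=
        (hc.fderiv_right (m := ∞) (by simp)).clm_apply contDiffAt_const
      simpa using this
    have hprod : ∀ c : ℝ → E, ContDiffAt ℝ ∞ c 0 → ∀ i,
        iteratedDeriv i (fun t => (c t, deriv c t)) 0
          = (iteratedDeriv i c 0, iteratedDeriv (i + 1) c 0) := by
      intro c hc i
      have hc' := hder c hc
      have hp : ContDiffAt ℝ ∞ (fun t => (c t, deriv c t)) 0 := hc.prodMk hc'
      have hi : ((i : ℕ) : WithTop ℕ∞) ≤ ∞ := by exact_mod_cast le_top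
      have e1 : iteratedFDeriv ℝ i (fun t => (c t, deriv c t)) 0
          = (iteratedFDeriv ℝ i c 0).prod (iteratedFDeriv ℝ i (deriv c) 0) :=
        iteratedFDeriv_prodMk (hc.of_le hi) (hc'.of_le hi) le_rfl
      rw [iteratedDeriv_succ', iteratedDeriv, e1]
      rfl
    rw [iteratedDeriv_succ', iteratedDeriv_succ']
    rw [(key a ha hf).iteratedDeriv_eq, (key b hb (h0 ▸ hf)).iteratedDeriv_eq]
    refine ih _ _ _ ?_ (ha.prodMk (hder a ha)) (hb.prodMk (hder b hb)) ?_ j (by omega)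
    · have h3 : ContDiffAt ℝ ∞ (fderiv ℝ f) (a 0) := hf.fderiv_right (m := ∞) (by simp)
      exact (ContDiffAt.comp (a 0, deriv a 0) h3 contDiffAt_fst).clm_apply contDiffAt_snd
    · intro i hi
      rw [hprod a ha, hprod b hb, h i (by omega), h (i + 1) (by omega)]

end Jets

section Osc

variable (E : Type u) [NormedAddCommGroup E] [NormedSpace ℝ E]
  {M : Type v} [TopologicalSpace M] [ChartedSpace E M]

/-- The set `C_x` of smooth curves `γ : (-ε, ε) → M` with `γ 0 = x`. The values of `toFun` off
`(-ε, ε)` are irrelevant. -/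
structure CurveAt (x : M) where
  toFun : ℝ → M
  smooth : ∃ ε : ℝ, 0 < ε ∧ ContMDiffOn 𝓘(ℝ, ℝ) 𝓘(ℝ, E) ∞ toFun (Ioo (-ε) ε)
  map_zero : toFun 0 = x

/-- `k`-equivalence of curves through `x`: all derivatives at `0` of orders `1, …, k` agree,
as read in the charts of the smooth structure around `x`. -/
def kSetoid (k : ℕ) (x : M) : Setoid (CurveAt E x) where
  r γ δ := ∀ φ ∈ IsManifold.maximalAtlas 𝓘(ℝ, E) ∞ M, x ∈ φ.source →
    ∀ j : ℕ, 1 ≤ j → j ≤ k →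
      iteratedDeriv j (fun t => φ (γ.toFun t)) 0 = iteratedDeriv j (fun t => φ (δ.toFun t)) 0
  iseqv :=
    { refl := fun _ _ _ _ _ _ _ => rfl
      symm := fun h φ hφ hx j h1 hj => (h φ hφ hx j h1 hj).symm
      trans := fun h h' φ hφ hx j h1 hj => (h φ hφ hx j h1 hj).trans (h' φ hφ hx j h1 hj) }

/-- The fibre `T^k_x M`. -/
abbrev OscFiber (k : ℕ) (x : M) : Type v := Quotient (kSetoid E k x)

variable (M) in
/-- The tangent bundle of order `k`, `T^k M = ⋃ₓ T^k_x M`; its points are the `[γ, x]_k`. -/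
abbrev Osc (k : ℕ) : Type v := Σ x : M, OscFiber E k x

/-- The canonical projection `π^k_M : T^k M → M`. -/
def oscProj (k : ℕ) (p : Osc E M k) : M := p.1

/-- The point `[γ, x]_k`. -/
def oscMk (k : ℕ) (x : M) (γ : CurveAt E x) : Osc E M k := ⟨x, Quotient.mk (kSetoid E k x) γ⟩

variable {E}

theorem chart_curve_contDiffAt [IsManifold 𝓘(ℝ, E) ∞ M] {x : M} (γ : CurveAt E x)
    {φ : OpenPartialHomeomorph M E} (hφ : φ ∈ IsManifold.maximalAtlas 𝓘(ℝ, E) ∞ M)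
    (hx : x ∈ φ.source) : ContDiffAt ℝ ∞ (fun t => φ (γ.toFun t)) 0 := by
  obtain ⟨ε, hε, hγ⟩ := γ.smooth
  have h1 : ContMDiffAt 𝓘(ℝ, ℝ) 𝓘(ℝ, E) ∞ γ.toFun 0 :=
    hγ.contMDiffAt (Ioo_mem_nhds (by linarith) hε)
  have h2 : ContMDiffAt 𝓘(ℝ, E) 𝓘(ℝ, E) ∞ φ (γ.toFun 0) :=
    contMDiffAt_of_mem_maximalAtlas hφ (by rw [γ.map_zero]; exact hx)
  exact (h2.comp (0 : ℝ) h1).contDiffAt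

variable {E' : Type w} [NormedAddCommGroup E'] [NormedSpace ℝ E']
  {N : Type*} [TopologicalSpace N] [ChartedSpace E' N]

/-- The curve `g ∘ γ`. -/
def CurveAt.map (g : M → N) (hg : ContMDiff 𝓘(ℝ, E) 𝓘(ℝ, E') ∞ g) {x : M} (γ : CurveAt E x) :
    CurveAt E' (g x) where
  toFun := fun t => g (γ.toFun t)
  smooth := by
    obtain ⟨ε, hε, hγ⟩ := γ.smooth
    exact ⟨ε, hε, hg.comp_contMDiffOn hγ⟩
  map_zero := by rw [γ.map_zero]

theorem kSetoid_map [IsManifold 𝓘(ℝ, E) ∞ M] [IsManifold 𝓘(ℝ, E') ∞ N] (k : ℕ)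
    (g : M → N) (hg : ContMDiff 𝓘(ℝ, E) 𝓘(ℝ, E') ∞ g) {x : M} (γ δ : CurveAt E x)
    (h : (kSetoid E k x).r γ δ) : (kSetoid E' k (g x)).r (γ.map g hg) (δ.map g hg) := by
  intro ψ hψ hy j h1 hj
  set φ := chartAt E x with hφdef
  have hφ : φ ∈ IsManifold.maximalAtlas 𝓘(ℝ, E) ∞ M := IsManifold.chart_mem_maximalAtlas x
  have hx : x ∈ φ.source := mem_chart_source E x
  have hf : ContDiffAt ℝ ∞ (fun e => ψ (g (φ.symm e))) (φ x) := by
    have a1 : ContMDiffAt 𝓘(ℝ, E) 𝓘(ℝ, E) ∞ φ.symm (φ x) :=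
      contMDiffAt_symm_of_mem_maximalAtlas hφ (φ.map_source hx)
    have a2 : ContMDiffAt 𝓘(ℝ, E) 𝓘(ℝ, E') ∞ (g ∘ φ.symm) (φ x) :=
      hg.contMDiffAt.comp (φ x) a1
    have a3 : ContMDiffAt 𝓘(ℝ, E') 𝓘(ℝ, E') ∞ ψ ((g ∘ φ.symm) (φ x)) :=
      contMDiffAt_of_mem_maximalAtlas hψ (by simpa [φ.left_inv hx] using hy)
    exact (a3.comp (φ x) a2).contDiffAt
  have hev : ∀ c : CurveAt E x, (fun t => ψ ((c.map g hg).toFun t)) =ᶠ[𝓝 0]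
      ((fun e => ψ (g (φ.symm e))) ∘ fun t => φ (c.toFun t)) := by
    intro c
    obtain ⟨ε, hε, hc⟩ := c.smooth
    have hcont : ContinuousAt c.toFun 0 :=
      (hc.contMDiffAt (Ioo_mem_nhds (by linarith) hε)).continuousAt
    have : ∀ᶠ t in 𝓝 (0 : ℝ), c.toFun t ∈ φ.source :=
      hcont.eventually (φ.open_source.mem_nhds (by rw [c.map_zero]; exact hx))
    filter_upwards [this] with t ht
    simp [CurveAt.map, φ.left_inv ht]
  rw [(hev γ).iteratedDeriv_eq, (hev δ).iteratedDeriv_eq]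
  refine jet_comp k _ _ _ (by simpa [γ.map_zero] using hf) (chart_curve_contDiffAt γ hφ hx)
    (chart_curve_contDiffAt δ hφ hx) ?_ j hj
  intro i hi
  rcases Nat.eq_zero_or_pos i with rfl | hpos
  · simp [γ.map_zero, δ.map_zero]
  · exact h φ hφ hx i hpos hi

/-- The `k`-th order differential `T^k g : T^k M → T^k N`, `[γ, x]_k ↦ [g ∘ γ, g x]_k`. -/
def oscMap [IsManifold 𝓘(ℝ, E) ∞ M] [IsManifold 𝓘(ℝ, E') ∞ N] (k : ℕ)
    (g : M → N) (hg : ContMDiff 𝓘(ℝ, E) 𝓘(ℝ, E') ∞ g) (p : Osc E M k) : Osc E' N k :=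
  ⟨g p.1, Quotient.map' (s₁ := kSetoid E k p.1) (s₂ := kSetoid E' k (g p.1))
    (CurveAt.map g hg) (kSetoid_map k g hg) p.2⟩

open Classical in
/-- The chart `φ^k` of `T^k M` induced by a chart `φ` of `M`: the point `[γ, x]_k` with `x` in the
domain of `φ` is sent to `((φ∘γ)(0), (φ∘γ)'(0), …, (φ∘γ)^{(k)}(0)/k!)`; elsewhere the value is the
irrelevant value `0`. -/
def jetCoord (k : ℕ) (φ : OpenPartialHomeomorph M E) (p : Osc E M k) : Fin (k + 1) → E :=
  Quotient.lift (s := kSetoid E k p.1)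
    (fun γ : CurveAt E p.1 =>
      if φ ∈ IsManifold.maximalAtlas 𝓘(ℝ, E) ∞ M ∧ p.1 ∈ φ.source then
        fun j : Fin (k + 1) =>
          ((Nat.factorial j : ℝ)⁻¹) • iteratedDeriv (j : ℕ) (fun t => φ (γ.toFun t)) 0
      else 0)
    (by
      intro γ δ h
      show (if _ then _ else _) = (if _ then _ else _)
      split_ifs with hφ
      · funext j
        rcases Nat.eq_zero_or_pos (j : ℕ) with hj | hj
        · simp [hj, γ.map_zero, δ.map_zero]
        · rw [h φ hφ.1 hφ.2 j hj (by omega)]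
      · rfl)
    p.2

end Osc

/-! ### Linear connections -/

section Connection

variable (E : Type u) [NormedAddCommGroup E] [NormedSpace ℝ E]
  (M : Type v) [TopologicalSpace M] [ChartedSpace E M] [IsManifold 𝓘(ℝ, E) ∞ M]

/-- `TM`. -/
abbrev TM : Type _ := TangentBundle 𝓘(ℝ, E) M

instance instIsManifoldTM : IsManifold 𝓘(ℝ, E).tangent ∞ (TM E M) := by
  have : IsManifold 𝓘(ℝ, E) (∞ + 1) M := by simpa using ‹IsManifold 𝓘(ℝ, E) ∞ M›
  exact Bundle.TotalSpace.isManifold E (TangentSpace 𝓘(ℝ, E))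

/-- `TTM`. -/
abbrev TTM : Type _ := TangentBundle 𝓘(ℝ, E).tangent (TM E M)

variable {M}

/-- Scalar multiplication by `c` in the fibres of `TM`. -/
def fiberSmul (c : ℝ) (p : TM E M) : TM E M := ⟨p.1, c • p.2⟩

/-- The tangent vector at `t = 0` of the curve `t ↦ p + t v` in the fibre of `TM` through `p`. -/
def verticalLift (p : TM E M) (v : TangentSpace 𝓘(ℝ, E) p.proj) :
    TangentSpace 𝓘(ℝ, E).tangent p :=
  mfderiv 𝓘(ℝ, ℝ) 𝓘(ℝ, E).tangent
    (fun t : ℝ => (⟨p.proj, p.2 + t • v⟩ : TM E M)) 0 (1 : ℝ)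

/-- The differential `(π_M)_*` at `p` of the projection `π_M : TM → M`. -/
def dProj (p : TM E M) :
    TangentSpace 𝓘(ℝ, E).tangent p →L[ℝ] TangentSpace 𝓘(ℝ, E) p.proj :=
  mfderiv 𝓘(ℝ, E).tangent 𝓘(ℝ, E) (fun q : TM E M => q.proj) p

/-- The vertical endomorphism `J` of `TTM`, locally `(x, ξ; y, η) ↦ (x, ξ; 0, y)`. -/
def vertEndo (p : TM E M) (w : TangentSpace 𝓘(ℝ, E).tangent p) :
    TangentSpace 𝓘(ℝ, E).tangent p :=
  verticalLift E p (dProj E p w)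

variable (M)

/-- A linear connection on `M`, given by its connection map `K : TTM → TM`: a smooth vector bundle
morphism over `π_M : TM → M` (with fibre maps `fiberMap p : T_p TM → T_{π p} M`) such that
`K ∘ J = (π_M)_*` and such that `K` is homogeneous of degree one, i.e. commutes with fibrewise
scalar multiplication. By smoothness, the latter means that the local components `Γ(x, ξ) y`, see
`christoffel`, are linear in `ξ`, too. -/
structure LinearConnection where
  fiberMap : ∀ p : TM E M,
    TangentSpace 𝓘(ℝ, E).tangent p →L[ℝ] TangentSpace 𝓘(ℝ, E) p.proj
  smooth : ContMDiff 𝓘(ℝ, E).tangent.tangent 𝓘(ℝ, E).tangent ∞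
    (fun w : TTM E M => (⟨w.proj.proj, fiberMap w.proj w.2⟩ : TM E M))
  vertical : ∀ (p : TM E M) (w : TangentSpace 𝓘(ℝ, E).tangent p),
    fiberMap p (vertEndo E p w) = dProj E p w
  homogeneous : ∀ (c : ℝ) (p : TM E M) (w : TangentSpace 𝓘(ℝ, E).tangent p),
    fiberMap (fiberSmul E c p)
      (mfderiv 𝓘(ℝ, E).tangent 𝓘(ℝ, E).tangent (fiberSmul E c) p w) = c • fiberMap p w

variable {E M}

/-- The connection map `K : TTM → TM`. -/
def LinearConnection.K (D : LinearConnection E M) (w : TTM E M) : TM E M :=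
  ⟨w.proj.proj, D.fiberMap w.proj w.2⟩

/-- `∇_M` and `∇_N` are `g`-related: `K_N ∘ TTg = Tg ∘ K_M`. -/
def Related {E' : Type w} [NormedAddCommGroup E'] [NormedSpace ℝ E']
    {N : Type*} [TopologicalSpace N] [ChartedSpace E' N] [IsManifold 𝓘(ℝ, E') ∞ N]
    (g : M → N) (DM : LinearConnection E M) (DN : LinearConnection E' N) : Prop :=
  ∀ w : TTM E M,
    DN.K (tangentMap 𝓘(ℝ, E).tangent 𝓘(ℝ, E').tangent (tangentMap 𝓘(ℝ, E) 𝓘(ℝ, E') g) w)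
      = tangentMap 𝓘(ℝ, E) 𝓘(ℝ, E') g (DM.K w)

/-- `(Tφ)⁻¹ : φ(U) × E → TM`. -/
def tangentChartSymm (φ : OpenPartialHomeomorph M E) (q : E × E) : TM E M :=
  ⟨φ.symm q.1, mfderiv 𝓘(ℝ, E) 𝓘(ℝ, E) φ.symm q.1 q.2⟩

/-- The local component (Christoffel symbol) `Γ_φ(x, ξ) y` of a linear connection: the principal
part of `Tφ ∘ K ∘ (TTφ)⁻¹` at `(x, ξ; y, 0)`. In the chart, `K` is
`(x, ξ; y, η) ↦ (x, η + Γ_φ(x, ξ) y)`. -/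
def LinearConnection.christoffel (D : LinearConnection E M) (φ : OpenPartialHomeomorph M E)
    (x ξ y : E) : E :=
  mfderiv 𝓘(ℝ, E) 𝓘(ℝ, E) φ (φ.symm x)
    (D.fiberMap (tangentChartSymm φ (x, ξ))
      (mfderiv 𝓘(ℝ, E × E) 𝓘(ℝ, E).tangent (tangentChartSymm φ) (x, ξ) (y, (0 : E))))

/-- The entry `u_j` of `u = (u_0, …, u_k)`, and `0` for `j > k`. -/
def entry {k : ℕ} (u : Fin (k + 1) → E) (j : ℕ) : E :=
  if h : j < k + 1 then u ⟨j, h⟩ else 0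

/-- For `u = (x, ξ_1, …, ξ_k)`, the vector `(ξ_1, 2 ξ_2, …, k ξ_k, 0)`. -/
def shift {k : ℕ} (u : Fin (k + 1) → E) : Fin (k + 1) → E :=
  fun j => ((j : ℕ) + 1 : ℝ) • entry u ((j : ℕ) + 1)

/-- The local components `M^i(u) y`, `u = (x, ξ_1, …, ξ_k)`, `i ≤ k`, of the connection map on
`T^k M` induced by a linear connection with local component `Γ`. With the convention
`M^0(u) y = y`, they are given by
`M^{i+1}(u) y = (1/(i+1)) (∑_{j=1}^{i+1} ∂_j M^i(x, ξ_1, …, ξ_i)(y, j ξ_j) + M^1(u)(M^i(u) y))`,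
where `∂_j` is the partial derivative in the `j`-th entry of `(x, ξ_1, …, ξ_i)`;
in particular `M^1(u) y = Γ(x, ξ_1) y`. -/
def liftComp {k : ℕ} (Γ : E → E → E → E) : ℕ → (Fin (k + 1) → E) → E → E
  | 0, _, y => y
  | i + 1, u, y => ((i : ℝ) + 1)⁻¹ •
      (fderiv ℝ (fun u' => liftComp Γ i u' y) u (shift u)
        + Γ (entry u 0) (entry u 1) (liftComp Γ i u y))

/-- With `u = (γ_φ(0), γ_φ'(0), …, γ_φ^{(k)}(0)/k!)`, the vector
`z^i = (1/i) (γ_φ^{(i)}(0)/(i-1)! + M^1(u) γ_φ^{(i-1)}(0)/(i-2)! + … + M^{i-1}(u) γ_φ'(0))`;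
note `γ_φ^{(l)}(0)/(l-1)! = l u_l`. -/
def zComp {k : ℕ} (Γ : E → E → E → E) (u : Fin (k + 1) → E) (i : ℕ) : E :=
  (i : ℝ)⁻¹ • ∑ j ∈ Finset.range i, liftComp Γ j u (((i - j : ℕ) : ℝ) • entry u (i - j))

/-- The trivialization `Φ^k_φ : π⁻¹(U) → φ(U) × E^k`, `[γ, x]_k ↦ (φ x, z^1, …, z^k)`
determined by a linear connection and a chart `(U, φ)`. -/
def oscTriv (D : LinearConnection E M) (k : ℕ) (φ : OpenPartialHomeomorph M E)
    (p : Osc E M k) : E × (Fin k → E) :=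
  (φ (oscProj E k p), fun i => zComp (D.christoffel φ) (jetCoord k φ p) ((i : ℕ) + 1))

end Connection

/-! ### Vector bundles given by trivializations -/

section VectorBundles

variable {E : Type*} [NormedAddCommGroup E] [NormedSpace ℝ E]
  {M : Type*} [TopologicalSpace M] [ChartedSpace E M]
  {F : Type*} [NormedAddCommGroup F] [NormedSpace ℝ F] {X : Type*}
  {E' : Type*} [NormedAddCommGroup E'] [NormedSpace ℝ E']
  {N : Type*} [TopologicalSpace N] [ChartedSpace E' N]
  {F' : Type*} [NormedAddCommGroup F'] [NormedSpace ℝ F'] {X' : Type*}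

/-- The maps `Φ φ : π⁻¹(U) → φ(U) × F`, one for every chart `(U, φ)` of the smooth structure of
`M`, define a smooth vector bundle structure with fibre type `F` and structure group `GL(F)` on
`π : X → M`: they are bijections over `φ`, and the transition maps are fibrewise in `GL(F)` and
depend smoothly, as elements of `L(F, F)`, on the base point. -/
structure IsVectorBundleStructure (π : X → M) (Φ : OpenPartialHomeomorph M E → X → E × F) :
    Prop where
  base : ∀ φ ∈ IsManifold.maximalAtlas 𝓘(ℝ, E) ∞ M, ∀ p, π p ∈ φ.source → (Φ φ p).1 = φ (π p)
  bijOn : ∀ φ ∈ IsManifold.maximalAtlas 𝓘(ℝ, E) ∞ M,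
    BijOn (Φ φ) (π ⁻¹' φ.source) (φ.target ×ˢ univ)
  transition : ∀ φ ∈ IsManifold.maximalAtlas 𝓘(ℝ, E) ∞ M,
    ∀ ψ ∈ IsManifold.maximalAtlas 𝓘(ℝ, E) ∞ M, ∃ G : E → F ≃L[ℝ] F,
      ContDiffOn ℝ ∞ (fun x => (G x : F →L[ℝ] F)) (φ '' (φ.source ∩ ψ.source)) ∧
      ∀ p, π p ∈ φ.source ∩ ψ.source → (Φ ψ p).2 = G (φ (π p)) (Φ φ p).2

/-- `(f, g)` is a vector bundle morphism: `g` is smooth, `f` maps fibres to fibres over `g`, and in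
the trivializations `f` is fibrewise continuous linear and depends smoothly, as an element of
`L(F, F')`, on the base point. -/
structure IsVectorBundleMorphism (π : X → M) (Φ : OpenPartialHomeomorph M E → X → E × F)
    (π' : X' → N) (Φ' : OpenPartialHomeomorph N E' → X' → E' × F') (f : X → X') (g : M → N) :
    Prop where
  smooth_base : ContMDiff 𝓘(ℝ, E) 𝓘(ℝ, E') ∞ g
  proj_comp : ∀ p, π' (f p) = g (π p)
  local_form : ∀ φ ∈ IsManifold.maximalAtlas 𝓘(ℝ, E) ∞ M,
    ∀ ψ ∈ IsManifold.maximalAtlas 𝓘(ℝ, E') ∞ N, ∃ L : E → F →L[ℝ] F',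
      ContDiffOn ℝ ∞ L (φ '' (φ.source ∩ g ⁻¹' ψ.source)) ∧
      ∀ p, π p ∈ φ.source ∩ g ⁻¹' ψ.source → (Φ' ψ (f p)).2 = L (φ (π p)) (Φ φ p).2

/-- `(f, g)` is a vector bundle isomorphism: a vector bundle morphism with a two-sided inverse
that is a vector bundle morphism. -/
def IsVectorBundleIso (π : X → M) (Φ : OpenPartialHomeomorph M E → X → E × F)
    (π' : X' → N) (Φ' : OpenPartialHomeomorph N E' → X' → E' × F') (f : X → X') (g : M → N) :
    Prop :=
  IsVectorBundleMorphism π Φ π' Φ' f g ∧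
    ∃ (f' : X' → X) (g' : N → M), IsVectorBundleMorphism π' Φ' π Φ f' g' ∧
      Function.LeftInverse f' f ∧ Function.RightInverse f' f ∧
      Function.LeftInverse g' g ∧ Function.RightInverse g' g

end VectorBundles

end HigherOrderTangent

end

/-! The components of the trivialization are iterated covariant derivatives: along a curve, `z^1` is
the velocity and the covariant derivative of `z^i` is `(i+1) z^{i+1}`
(`IsLocalConnection.covDeriv_zComp`), so `z^i` is `1/i!` times the `(i-1)`-st covariant derivative
of the velocity. The recursion for `M^i` is designed to make this true.

Read in charts, `g`-relatedness is the classical transformation law of Christoffel symbols under the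
local representative `τ` of `g` (`christoffel_related`). By this law the covariant derivative
commutes with `Dτ` (`covDeriv_map`), so by induction every `z^i` is transformed by the one linear
map `Dτ(x)` (`zComp_map`). Thus `T^k g` acts on fibres as `Dτ(x)` on each factor of `E^k`: linear,
and smooth in `x` (`oscTriv_oscMap`).

Transition maps are the case `g = id`, every connection being `id`-related to itself. The inverse of
`T^k g` is `T^k` of `g⁻¹`, since relatedness passes to the inverse (`Related.symm`). The
trivializations are bijective because `z^i - u_i` depends only on `u_0, …, u_{i-1}`
(`zComp_sub_entry_congr`): the system is triangular in the jet coordinates. -/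

noncomputable section

namespace HigherOrderTangent

/-! ### Calculus of `M^i` and `z^i` in one chart. -/

section LocalCalculus

variable {E : Type*} [NormedAddCommGroup E] {k : ℕ}

theorem entry_add (u v : Fin (k + 1) → E) (j : ℕ) : entry (u + v) j = entry u j + entry v j := by
  unfold entry; split_ifs <;> simp

theorem entry_sub (u v : Fin (k + 1) → E) (j : ℕ) : entry (u - v) j = entry u j - entry v j := by
  unfold entry; split_ifs <;> simp

theorem entry_of_le (u : Fin (k + 1) → E) {j : ℕ} (hj : j ≤ k) :
    entry u j = u ⟨j, Nat.lt_succ_of_le hj⟩ := by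
  simp [entry, Nat.lt_succ_of_le hj]

variable [NormedSpace ℝ E]

/-- Local components of a connection on the open set `s`: smooth, and linear in the last entry. -/
structure IsLocalConnection (Γ : E → E → E → E) (s : Set E) : Prop where
  isOpen : IsOpen s
  smooth : ∀ x ∈ s, ∀ ξ y, ContDiffAt ℝ ∞ (fun q : E × E × E => Γ q.1 q.2.1 q.2.2) (x, ξ, y)
  linear : ∀ x ∈ s, ∀ ξ, IsLinearMap ℝ (Γ x ξ)

theorem contDiff_entry (j : ℕ) : ContDiff ℝ ∞ (fun u : Fin (k + 1) → E => entry u j) := by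
  unfold entry
  split_ifs <;> fun_prop

theorem contDiff_shift : ContDiff ℝ ∞ (fun u : Fin (k + 1) → E => shift u) := by
  unfold shift
  exact contDiff_pi.2 fun j => contDiff_const.smul (contDiff_entry _)

theorem entry_smul (a : ℝ) (u : Fin (k + 1) → E) (j : ℕ) : entry (a • u) j = a • entry u j := by
  unfold entry; split_ifs <;> simp

theorem entry_shift (u : Fin (k + 1) → E) (j : ℕ) :
    entry (shift u) j = ((j : ℝ) + 1) • entry u (j + 1) := by
  by_cases h : j < k + 1
  · simp [entry, shift, h]
  · simp [entry, h, show ¬ j < k by omega]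

/-- No differentiability is needed, because `fderiv` is `0` by default where it fails. This lets the
congruence lemmas below hold for an arbitrary `Γ`. -/
theorem fderiv_apply_eq_zero_of_invariant {F G : Type*} [NormedAddCommGroup F] [NormedSpace ℝ F]
    [NormedAddCommGroup G] [NormedSpace ℝ G] (f : F → G) (w x : F)
    (h : ∀ t : ℝ, f (x + t • w) = f x) : fderiv ℝ f x w = 0 := by
  by_cases hf : DifferentiableAt ℝ f x
  · rw [← hf.lineDeriv_eq_fderiv, lineDeriv]
    simp [h]
  · simp [fderiv_zero_of_not_differentiableAt hf]

theorem liftComp_succ (Γ : E → E → E → E) (i : ℕ) (u : Fin (k + 1) → E) (y : E) :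
    liftComp Γ (i + 1) u y = ((i : ℝ) + 1)⁻¹ •
      (fderiv ℝ (fun u' => liftComp Γ i u' y) u (shift u)
        + Γ (entry u 0) (entry u 1) (liftComp Γ i u y)) := rfl

/-- Such an `f` is invariant under translations that fix the entries up to `i`. Translating moves
the base point, and invariance kills the derivative in the difference of the directions. -/
theorem fderiv_congr_of_entry {G : Type*} [NormedAddCommGroup G] [NormedSpace ℝ G]
    (f : (Fin (k + 1) → E) → G) (i : ℕ)
    (hf : ∀ u u', (∀ j ≤ i, entry u j = entry u' j) → f u = f u')
    {u u' v v' : Fin (k + 1) → E} (hu : ∀ j ≤ i, entry u j = entry u' j)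
    (hv : ∀ j ≤ i, entry v j = entry v' j) : fderiv ℝ f u v = fderiv ℝ f u' v' := by
  have h1 : (fun x => f (x + (u' - u))) = f := by
    funext x
    refine hf _ _ fun j hj => ?_
    rw [entry_add, entry_sub, hu j hj]; simp
  have h2 : fderiv ℝ f u = fderiv ℝ f u' := by
    conv_lhs => rw [← h1]
    rw [fderiv_comp_add_right]; simp
  have h3 : fderiv ℝ f u' (v' - v) = 0 := by
    refine fderiv_apply_eq_zero_of_invariant f _ _ fun t => hf _ _ fun j hj => ?_
    rw [entry_add, entry_smul, entry_sub, hv j hj]; simp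
  rw [map_sub, sub_eq_zero] at h3
  rw [h2, h3]

/-- Each step of the recursion sees one entry more, because `shift` moves entry `j + 1` to place
`j`. Hence `M^i` does not depend on the ambient `k`-jet beyond order `i`. -/
theorem liftComp_congr (Γ : E → E → E → E) (i : ℕ) : ∀ (u u' : Fin (k + 1) → E) (y : E),
    (∀ j ≤ i, entry u j = entry u' j) → liftComp Γ i u y = liftComp Γ i u' y := by
  induction i with
  | zero => intro u u' y _; rfl
  | succ i ih =>
    intro u u' y h
    rw [liftComp_succ, liftComp_succ, h 0 (by omega), h 1 (by omega),
      ih u u' y fun j hj => h j (by omega),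
      fderiv_congr_of_entry (fun u' => liftComp Γ i u' y) i (fun a b hab => ih a b y hab)
        (fun j hj => h j (by omega)) (v := shift u) (v' := shift u')]
    intro j hj
    rw [entry_shift, entry_shift, h (j + 1) (by omega)]

theorem zComp_congr (Γ : E → E → E → E) (i : ℕ) (u u' : Fin (k + 1) → E)
    (h : ∀ j ≤ i, entry u j = entry u' j) : zComp Γ u i = zComp Γ u' i := by
  unfold zComp
  congr 1
  refine Finset.sum_congr rfl fun j hj => ?_
  rw [Finset.mem_range] at hj
  rw [h (i - j) (by omega)]
  exact liftComp_congr Γ j u u' _ fun l hl => h l (by omega)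

variable {Γ : E → E → E → E} {s : Set E}

/-- Smoothness is proved jointly in `u` and `y`: the recursion takes a `u`-derivative with `y` as
parameter, and `y` will later vary along a curve. -/
theorem IsLocalConnection.contDiffAt_liftComp (hΓ : IsLocalConnection Γ s) (i : ℕ) :
    ∀ (u : Fin (k + 1) → E) (y : E), entry u 0 ∈ s →
      ContDiffAt ℝ ∞ (fun p : (Fin (k + 1) → E) × E => liftComp Γ i p.1 p.2) (u, y) := by
  induction i with
  | zero => intro u y _; exact contDiffAt_snd
  | succ i ih =>
    intro u y hu
    simp only [liftComp_succ]
    refine contDiffAt_const.smul (ContDiffAt.add ?_ ?_)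
    · refine ContDiffAt.clm_apply (ContDiffAt.fderiv (n := ∞)
        (f := fun (p : (Fin (k + 1) → E) × E) u' => liftComp Γ i u' p.2) (g := Prod.fst)
        ?_ contDiffAt_fst (by simp)) (contDiff_shift.contDiffAt.comp (u, y) contDiffAt_fst)
      exact (ih u y hu).comp (((u, y), u) : ((Fin (k + 1) → E) × E) × (Fin (k + 1) → E))
        (contDiffAt_snd.prodMk (contDiffAt_snd.comp _ contDiffAt_fst))
    · exact (hΓ.smooth (entry u 0) hu (entry u 1) (liftComp Γ i u y)).comp
        ((u, y) : (Fin (k + 1) → E) × E)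
        (((contDiff_entry 0).contDiffAt.comp (u, y) contDiffAt_fst).prodMk
          (((contDiff_entry 1).contDiffAt.comp (u, y) contDiffAt_fst).prodMk (ih u y hu)))

theorem IsLocalConnection.contDiffAt_liftComp_left (hΓ : IsLocalConnection Γ s) (i : ℕ)
    (u : Fin (k + 1) → E) (y : E) (hu : entry u 0 ∈ s) :
    ContDiffAt ℝ ∞ (fun u' : Fin (k + 1) → E => liftComp Γ i u' y) u :=
  (hΓ.contDiffAt_liftComp i u y hu).comp u (contDiffAt_id.prodMk contDiffAt_const)

theorem IsLocalConnection.eventually_entry (hΓ : IsLocalConnection Γ s) {u : Fin (k + 1) → E}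
    (hu : entry u 0 ∈ s) : ∀ᶠ u' in 𝓝 u, entry u' 0 ∈ s :=
  (contDiff_entry 0).continuous.continuousAt.eventually (hΓ.isOpen.mem_nhds hu)

theorem IsLocalConnection.isLinearMap_liftComp (hΓ : IsLocalConnection Γ s) (i : ℕ) :
    ∀ u : Fin (k + 1) → E, entry u 0 ∈ s → IsLinearMap ℝ (liftComp Γ i u) := by
  induction i with
  | zero => intro u _; exact ⟨fun _ _ => rfl, fun _ _ => rfl⟩
  | succ i ih =>
    intro u hu
    have hd : ∀ y, DifferentiableAt ℝ (fun u' : Fin (k + 1) → E => liftComp Γ i u' y) u :=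
      fun y => (hΓ.contDiffAt_liftComp_left i u y hu).differentiableAt (by simp)
    have hl := hΓ.linear _ hu (entry u 1)
    constructor
    · intro y y'
      have he : (fun u' : Fin (k + 1) → E => liftComp Γ i u' (y + y')) =ᶠ[𝓝 u]
          fun u' => liftComp Γ i u' y + liftComp Γ i u' y' := by
        filter_upwards [hΓ.eventually_entry hu] with u' hu'
        exact (ih u' hu').map_add y y'
      rw [liftComp_succ, liftComp_succ, liftComp_succ, he.fderiv_eq, (ih u hu).map_add, hl.map_add,
        fderiv_fun_add (hd y) (hd y'), ← smul_add]
      congr 1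
      simp only [add_apply]
      abel
    · intro a y
      have he : (fun u' : Fin (k + 1) → E => liftComp Γ i u' (a • y)) =ᶠ[𝓝 u]
          fun u' => a • liftComp Γ i u' y := by
        filter_upwards [hΓ.eventually_entry hu] with u' hu'
        exact (ih u' hu').map_smul a y
      rw [liftComp_succ, liftComp_succ, he.fderiv_eq, (ih u hu).map_smul, hl.map_smul,
        fderiv_fun_const_smul (hd y), smul_comm a]
      congr 1
      simp only [smul_apply, smul_add]

/-- The normalized Taylor coefficients of order `≤ k` of a curve. -/
def jetCurve (k : ℕ) (c : ℝ → E) (t : ℝ) : Fin (k + 1) → E :=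
  fun j => ((Nat.factorial j : ℝ)⁻¹) • iteratedDeriv (j : ℕ) c t

theorem entry_jetCurve (c : ℝ → E) (t : ℝ) {j : ℕ} (hj : j ≤ k) :
    entry (jetCurve k c t) j = ((Nat.factorial j : ℝ)⁻¹) • iteratedDeriv j c t := by
  rw [entry_of_le _ hj]; rfl

theorem contDiffAt_iteratedDeriv {c : ℝ → E} {t : ℝ} (hc : ContDiffAt ℝ ∞ c t) (j : ℕ) :
    ContDiffAt ℝ ∞ (iteratedDeriv j c) t := by
  induction j with
  | zero => simpa using hc
  | succ j ih =>
    rw [iteratedDeriv_succ]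
    have : ContDiffAt ℝ ∞ (fun t => fderiv ℝ (iteratedDeriv j c) t 1) t :=
      (ih.fderiv_right (m := ∞) (by simp)).clm_apply contDiffAt_const
    simpa using this

theorem contDiffAt_jetCurve {c : ℝ → E} {t : ℝ} (hc : ContDiffAt ℝ ∞ c t) :
    ContDiffAt ℝ ∞ (jetCurve k c) t :=
  contDiffAt_pi.2 fun j => contDiffAt_const.smul (contDiffAt_iteratedDeriv hc j)

theorem hasDerivAt_normalized {c : ℝ → E} {t : ℝ} (hc : ContDiffAt ℝ ∞ c t) (j : ℕ) :
    HasDerivAt (fun t => ((Nat.factorial j : ℝ)⁻¹) • iteratedDeriv j c t)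
      (((j : ℝ) + 1) • ((Nat.factorial (j + 1) : ℝ)⁻¹) • iteratedDeriv (j + 1) c t) t := by
  have h := (((contDiffAt_iteratedDeriv hc j).differentiableAt (by simp)).hasDerivAt).const_smul
    ((Nat.factorial j : ℝ)⁻¹)
  refine h.congr_deriv ?_
  rw [iteratedDeriv_succ, smul_smul]
  congr 1
  rw [Nat.factorial_succ]
  have : (Nat.factorial j : ℝ) ≠ 0 := by exact_mod_cast Nat.factorial_ne_zero j
  push_cast
  field_simp

theorem hasDerivAt_entry_jetCurve {c : ℝ → E} {t : ℝ} (hc : ContDiffAt ℝ ∞ c t) {j : ℕ}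
    (hj : j < k) : HasDerivAt (fun t => entry (jetCurve k c t) j)
      (((j : ℝ) + 1) • entry (jetCurve k c t) (j + 1)) t := by
  rw [entry_jetCurve c t (show j + 1 ≤ k by omega)]
  convert hasDerivAt_normalized hc j using 2 with t'
  exact entry_jetCurve c t' hj.le

/-- The covariant derivative along the curve `c` attached to the local components `Γ`. -/
def covDeriv (Γ : E → E → E → E) (c Y : ℝ → E) (t : ℝ) : E :=
  deriv Y t + Γ (c t) (deriv c t) (Y t)

/-- This is the recursion read along a curve: the covariant derivative of `M^i Y` is `(i+1) M^{i+1}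
Y + M^i Y'`. It holds because the velocity of the jet curve is its shift, up to the top entry. -/
theorem IsLocalConnection.hasDerivAt_liftComp (hΓ : IsLocalConnection Γ s) {c Y : ℝ → E} {t : ℝ}
    (hc : ContDiffAt ℝ ∞ c t) (hs : c t ∈ s) {Y' : E} (hY : HasDerivAt Y Y' t) {i : ℕ}
    (hi : i < k) :
    HasDerivAt (fun t => liftComp Γ i (jetCurve k c t) (Y t))
      (((i : ℝ) + 1) • liftComp Γ (i + 1) (jetCurve k c t) (Y t)
        + liftComp Γ i (jetCurve k c t) Y' - Γ (c t) (deriv c t)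
          (liftComp Γ i (jetCurve k c t) (Y t))) t := by
  set u := jetCurve k c t with hu
  have e0 : entry u 0 = c t := by rw [hu, entry_jetCurve _ _ (by omega)]; simp
  have e1 : entry u 1 = deriv c t := by
    rw [hu, entry_jetCurve _ _ (by omega)]; simp
  have hu0 : entry u 0 ∈ s := e0 ▸ hs
  have hF : DifferentiableAt ℝ (fun p : (Fin (k + 1) → E) × E => liftComp Γ i p.1 p.2) (u, Y t) :=
    (hΓ.contDiffAt_liftComp i u (Y t) hu0).differentiableAt (by simp)
  have hj : HasDerivAt (jetCurve k c)
      (fun j => ((j : ℝ) + 1) • ((Nat.factorial (j + 1) : ℝ)⁻¹) • iteratedDeriv (j + 1) c t) t :=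
    hasDerivAt_pi.2 fun j => hasDerivAt_normalized hc j
  have key := hF.hasFDerivAt.comp_hasDerivAt t (hj.prodMk hY)
  refine key.congr_deriv ?_
  set u' : Fin (k + 1) → E :=
    fun j => ((j : ℝ) + 1) • ((Nat.factorial (j + 1) : ℝ)⁻¹) • iteratedDeriv (j + 1) c t with hu'
  have h1 : fderiv ℝ (fun p : (Fin (k + 1) → E) × E => liftComp Γ i p.1 p.2) (u, Y t) (u', 0)
      = fderiv ℝ (fun v => liftComp Γ i v (Y t)) u (shift u) := by
    have h := (hF.hasFDerivAt.comp u
      ((hasFDerivAt_id (𝕜 := ℝ) u).prodMk (hasFDerivAt_const (Y t) u))).fderiv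
    have h' : fderiv ℝ (fun v => liftComp Γ i v (Y t)) u u' =
        fderiv ℝ (fun p : (Fin (k + 1) → E) × E => liftComp Γ i p.1 p.2) (u, Y t) (u', 0) := by
      have := congrArg (fun L => L u') h
      simpa [Function.comp_def] using this
    rw [← h']
    -- The true velocity `u'` and `shift u` differ only in the top entry, where `shift` has `0` for
    -- the derivative of order `k + 1`; `M^i` with `i < k` does not see it.
    refine fderiv_congr_of_entry _ i (fun a b hab => liftComp_congr Γ i a b _ hab)
      (fun _ _ => rfl) fun j hj => ?_
    rw [entry_shift, hu, entry_jetCurve _ _ (by omega), entry_of_le _ (by omega)]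
  have hlin := hΓ.isLinearMap_liftComp i u hu0
  have h2 : fderiv ℝ (fun p : (Fin (k + 1) → E) × E => liftComp Γ i p.1 p.2) (u, Y t) (0, Y')
      = liftComp Γ i u Y' := by
    rw [← hF.lineDeriv_eq_fderiv, lineDeriv]
    simp only [Prod.mk_add_mk, Prod.smul_mk, smul_zero, add_zero, hlin.map_add, hlin.map_smul]
    simpa using (((hasDerivAt_id (0 : ℝ)).smul_const (liftComp Γ i u Y')).const_add
      (liftComp Γ i u (Y t))).deriv
  have h3 : ((u', Y') : (Fin (k + 1) → E) × E) = (u', 0) + (0, Y') := by simp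
  rw [h3, map_add, h1, h2, liftComp_succ, smul_smul,
    mul_inv_cancel₀ (by positivity), one_smul, e0, e1]
  abel

theorem IsLocalConnection.differentiableAt_zComp (hΓ : IsLocalConnection Γ s) {c : ℝ → E} {t : ℝ}
    (hc : ContDiffAt ℝ ∞ c t) (hs : c t ∈ s) (i : ℕ) :
    DifferentiableAt ℝ (fun t => zComp Γ (jetCurve k c t) i) t := by
  have hj := contDiffAt_jetCurve (k := k) hc
  have h0 : entry (jetCurve k c t) 0 ∈ s := by
    rw [entry_jetCurve _ _ (Nat.zero_le _)]; simpa using hs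
  unfold zComp
  refine DifferentiableAt.const_smul (DifferentiableAt.fun_sum fun j _ => ?_) _
  exact ((hΓ.contDiffAt_liftComp j _ _ h0).comp t (hj.prodMk
    (contDiffAt_const.smul ((contDiff_entry (i - j)).contDiffAt.comp t hj)))).differentiableAt
    (by simp)

/-- Write `i z^i` as the sum of the `b j` and `(i+1) z^{i+1}` as the sum of the `a j`. The covariant
derivative of `b j` is `(j+1) a (j+1) + (i-j) a j`, so after summation each `a j` has coefficient `j
+ (i-j) = i`. -/
theorem IsLocalConnection.covDeriv_zComp (hΓ : IsLocalConnection Γ s) {c : ℝ → E} {t : ℝ}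
    (hc : ContDiffAt ℝ ∞ c t) (hs : c t ∈ s) {i : ℕ} (h1 : 1 ≤ i) (hi : i < k) :
    covDeriv Γ c (fun t => zComp Γ (jetCurve k c t) i) t
      = ((i : ℝ) + 1) • zComp Γ (jetCurve k c t) (i + 1) := by
  have hi0 : (i : ℝ) ≠ 0 := by positivity
  set u := jetCurve k c t with hu
  have hu0 : entry u 0 ∈ s := by
    rw [hu, entry_jetCurve _ _ (Nat.zero_le _)]; simpa using hs
  set a : ℕ → E := fun j => liftComp Γ j u (((i + 1 - j : ℕ) : ℝ) • entry u (i + 1 - j)) with ha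
  set b : ℕ → E := fun j => liftComp Γ j u (((i - j : ℕ) : ℝ) • entry u (i - j)) with hb
  have hd : HasDerivAt (fun t => zComp Γ (jetCurve k c t) i)
      ((i : ℝ)⁻¹ • ∑ j ∈ Finset.range i, (((j : ℝ) + 1) • a (j + 1) + ((i : ℝ) - j) • a j
        - Γ (c t) (deriv c t) (b j))) t := by
    unfold zComp
    refine HasDerivAt.const_smul _ (HasDerivAt.fun_sum fun j hj => ?_)
    rw [Finset.mem_range] at hj
    have hY := (hasDerivAt_entry_jetCurve (k := k) hc (show i - j < k by omega)).const_smul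
      (((i - j : ℕ) : ℝ))
    refine (hΓ.hasDerivAt_liftComp (k := k) hc hs hY (show j < k by omega)).congr_deriv ?_
    have e1 : i + 1 - (j + 1) = i - j := by omega
    have e2 : i + 1 - j = i - j + 1 := by omega
    simp only [ha, hb, e1, e2, ← hu, Nat.cast_add, Nat.cast_one, Nat.cast_sub hj.le,
      Pi.smul_apply, (hΓ.isLinearMap_liftComp j u hu0).map_smul]
  have hl := hΓ.linear (c t) hs (deriv c t)
  have hz : zComp Γ u i = (i : ℝ)⁻¹ • ∑ j ∈ Finset.range i, b j := rfl
  have hsum : Γ (c t) (deriv c t) (∑ j ∈ Finset.range i, b j)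
      = ∑ j ∈ Finset.range i, Γ (c t) (deriv c t) (b j) := map_sum hl.mk' b (Finset.range i)
  have hcomb : ∑ j ∈ Finset.range i, (((j : ℝ) + 1) • a (j + 1) + ((i : ℝ) - j) • a j)
      = (i : ℝ) • ∑ j ∈ Finset.range (i + 1), a j := by
    rw [Finset.sum_add_distrib]
    -- Both sums extend to `range (i + 1)` because the added terms, at `j = 0` and at `j = i`, have
    -- coefficient zero.
    have q1 : ∑ j ∈ Finset.range i, ((j : ℝ) + 1) • a (j + 1)
        = ∑ j ∈ Finset.range (i + 1), (j : ℝ) • a j := by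
      rw [Finset.sum_range_succ']; simp
    have q2 : ∑ j ∈ Finset.range i, ((i : ℝ) - j) • a j
        = ∑ j ∈ Finset.range (i + 1), ((i : ℝ) - j) • a j := by
      rw [Finset.sum_range_succ]; simp
    rw [q1, q2, ← Finset.sum_add_distrib, Finset.smul_sum]
    refine Finset.sum_congr rfl fun j _ => ?_
    rw [← add_smul]; congr 1; ring
  rw [covDeriv, hd.deriv, ← hu, hz, hl.map_smul, hsum, ← smul_add, ← Finset.sum_add_distrib]
  simp only [sub_add_cancel]
  rw [hcomb, smul_smul, inv_mul_cancel₀ hi0, one_smul, zComp, smul_smul]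
  push_cast
  rw [mul_inv_cancel₀ (by positivity), one_smul]

theorem zComp_one (Γ : E → E → E → E) (u : Fin (k + 1) → E) : zComp Γ u 1 = entry u 1 := by
  simp [zComp, liftComp]

end LocalCalculus

/-! ### Naturality of the covariant derivative and of `z^i`. -/

section Transformation

variable {E : Type*} [NormedAddCommGroup E] [NormedSpace ℝ E] {k : ℕ}

/-- The product rule gives the second derivative of `τ` in the order `(c', Z)`, while `law` has the
opposite order; symmetry of the second derivative reconciles them. -/
theorem covDeriv_map {E' : Type*} [NormedAddCommGroup E'] [NormedSpace ℝ E']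
    {Γ : E → E → E → E} {Γ' : E' → E' → E' → E'} {τ : E → E'} {c Z : ℝ → E} {t : ℝ}
    (hτ : ContDiffAt ℝ ∞ τ (c t)) (hc : DifferentiableAt ℝ c t) (hZ : DifferentiableAt ℝ Z t)
    (law : ∀ ξ y, fderiv ℝ (fderiv ℝ τ) (c t) y ξ
      + Γ' (τ (c t)) (fderiv ℝ τ (c t) ξ) (fderiv ℝ τ (c t) y) = fderiv ℝ τ (c t) (Γ (c t) ξ y)) :
    covDeriv Γ' (fun t => τ (c t)) (fun t => fderiv ℝ τ (c t) (Z t)) t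
      = fderiv ℝ τ (c t) (covDeriv Γ c Z t) := by
  have h1 : HasDerivAt (fun t => τ (c t)) (fderiv ℝ τ (c t) (deriv c t)) t :=
    (hτ.differentiableAt (by simp)).hasFDerivAt.comp_hasDerivAt t hc.hasDerivAt
  have h2 : HasDerivAt (fun t => fderiv ℝ τ (c t))
      (fderiv ℝ (fderiv ℝ τ) (c t) (deriv c t)) t :=
    ((hτ.fderiv_right (m := ∞) (by simp)).differentiableAt
      (by simp)).hasFDerivAt.comp_hasDerivAt t hc.hasDerivAt
  have hsymm : IsSymmSndFDerivAt ℝ τ (c t) := (contDiffAt_infty.1 hτ 2).isSymmSndFDerivAt (by simp)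
  rw [covDeriv, covDeriv, h1.deriv, (h2.clm_apply hZ.hasDerivAt).deriv, map_add, ← law,
    hsymm.eq (deriv c t)]
  abel

/-- The components `z^i` of a curve transform by the derivative of a change of coordinates that
relates the local components of two connections. -/
theorem zComp_map {E' : Type*} [NormedAddCommGroup E'] [NormedSpace ℝ E']
    {Γ : E → E → E → E} {Γ' : E' → E' → E' → E'} {s : Set E} {s' : Set E'}
    (hΓ : IsLocalConnection Γ s) (hΓ' : IsLocalConnection Γ' s') {τ : E → E'} {o : Set E}
    (hos : o ⊆ s) (hτ : ∀ x ∈ o, ContDiffAt ℝ ∞ τ x) (hτs : ∀ x ∈ o, τ x ∈ s')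
    (law : ∀ x ∈ o, ∀ ξ y, fderiv ℝ (fderiv ℝ τ) x y ξ
      + Γ' (τ x) (fderiv ℝ τ x ξ) (fderiv ℝ τ x y) = fderiv ℝ τ x (Γ x ξ y))
    {I : Set ℝ} (hI : IsOpen I) {c : ℝ → E} (hc : ∀ t ∈ I, ContDiffAt ℝ ∞ c t)
    (hco : ∀ t ∈ I, c t ∈ o) {i : ℕ} (h1 : 1 ≤ i) : i ≤ k → ∀ t ∈ I,
      zComp Γ' (jetCurve k (fun t => τ (c t)) t) i
        = fderiv ℝ τ (c t) (zComp Γ (jetCurve k c t) i) := by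
  have hτc : ∀ t ∈ I, ContDiffAt ℝ ∞ (fun t => τ (c t)) t := fun t ht =>
    (hτ _ (hco t ht)).comp t (hc t ht)
  induction i, h1 using Nat.le_induction with
  | base =>
    intro hk t ht
    rw [zComp_one, zComp_one, entry_jetCurve _ _ hk, entry_jetCurve _ _ hk]
    simp only [Nat.factorial_one, Nat.cast_one, inv_one, one_smul, iteratedDeriv_one]
    exact (((hτ _ (hco t ht)).differentiableAt (by simp)).hasFDerivAt.comp_hasDerivAt t
      ((hc t ht).differentiableAt (by simp)).hasDerivAt).deriv
  | succ i h1 ih =>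
    intro hk t ht
    -- The induction hypothesis must be differentiated in `t`, so it is needed near `t` and not only
    -- at `t`; hence the statement over an open set `I` of times.
    have he : (fun t => zComp Γ' (jetCurve k (fun t => τ (c t)) t) i) =ᶠ[𝓝 t]
        fun t => fderiv ℝ τ (c t) (zComp Γ (jetCurve k c t) i) := by
      filter_upwards [hI.mem_nhds ht] with t' ht'
      exact ih (by omega) t' ht'
    have hcov : ∀ Y Y' : ℝ → E', Y =ᶠ[𝓝 t] Y' →
        covDeriv Γ' (fun t => τ (c t)) Y t = covDeriv Γ' (fun t => τ (c t)) Y' t := by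
      intro Y Y' h
      rw [covDeriv, covDeriv, h.deriv_eq, h.eq_of_nhds]
    have e1 := hΓ'.covDeriv_zComp (k := k) (hτc t ht) (hτs _ (hco t ht)) h1 (by omega)
    have e2 := hΓ.covDeriv_zComp (k := k) (hc t ht) (hos (hco t ht)) h1 (by omega)
    rw [hcov _ _ he, covDeriv_map (Γ := Γ) (hτ _ (hco t ht))
      ((hc t ht).differentiableAt (by simp))
      (hΓ.differentiableAt_zComp (hc t ht) (hos (hco t ht)) i) (law _ (hco t ht)), e2, map_smul]
      at e1
    exact (smul_right_injective E' (show (i : ℝ) + 1 ≠ 0 by positivity) e1).symm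

end Transformation

/-! ### Recovering a jet from its components `z^i`. -/

section Triangular

variable {E : Type*} [NormedAddCommGroup E] [NormedSpace ℝ E] {k : ℕ}

/-- In `z^i` the term with `M^0` is `i⁻¹ • i • u_i = u_i`, and all other terms involve only entries
below `i`. -/
theorem zComp_sub_entry_congr (Γ : E → E → E → E) {i : ℕ} (h1 : 1 ≤ i)
    (u u' : Fin (k + 1) → E) (h : ∀ j < i, entry u j = entry u' j) :
    zComp Γ u i - entry u i = zComp Γ u' i - entry u' i := by
  obtain ⟨i, rfl⟩ : ∃ l, i = l + 1 := ⟨i - 1, by omega⟩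
  have key : ∀ v : Fin (k + 1) → E, zComp Γ v (i + 1) - entry v (i + 1) =
      ((i + 1 : ℕ) : ℝ)⁻¹ • ∑ j ∈ Finset.range i, liftComp Γ (j + 1) v
        (((i + 1 - (j + 1) : ℕ) : ℝ) • entry v (i + 1 - (j + 1))) := by
    intro v
    rw [zComp, Finset.sum_range_succ', smul_add]
    simp only [liftComp, Nat.sub_zero]
    rw [smul_smul, inv_mul_cancel₀ (by positivity), one_smul, add_sub_cancel_right]
  rw [key, key]
  congr 1
  refine Finset.sum_congr rfl fun j hj => ?_
  rw [Finset.mem_range] at hj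
  rw [h _ (by omega)]
  exact liftComp_congr Γ _ u u' _ fun l hl => h l (by omega)

theorem eq_of_zComp_eq (Γ : E → E → E → E) {u u' : Fin (k + 1) → E}
    (h0 : entry u 0 = entry u' 0) (h : ∀ i, 1 ≤ i → i ≤ k → zComp Γ u i = zComp Γ u' i) :
    u = u' := by
  have key : ∀ i, i ≤ k → entry u i = entry u' i := by
    intro i
    induction i using Nat.strong_induction_on with
    | _ i ih =>
      intro hi
      rcases Nat.eq_zero_or_pos i with rfl | hpos
      · exact h0
      · have := zComp_sub_entry_congr Γ hpos u u' fun j hj => ih j hj (by omega)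
        rw [h i hpos hi] at this
        exact sub_right_injective this
  funext j
  have := key j (by omega)
  rwa [entry_of_le _ (by omega), entry_of_le _ (by omega)] at this

/-- Forward substitution: entry `m + 1` is chosen to correct `z^{m+1}`, which leaves the components
of lower order unchanged. -/
theorem exists_zComp_eq (Γ : E → E → E → E) (x : E) (z : ℕ → E) (m : ℕ) :
    m ≤ k → ∃ u : Fin (k + 1) → E, entry u 0 = x ∧ ∀ i, 1 ≤ i → i ≤ m → zComp Γ u i = z i := by
  induction m with
  | zero => exact fun _ => ⟨fun _ => x, by simp [entry], fun i h1 h2 => by omega⟩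
  | succ m ih =>
    intro hm
    obtain ⟨u, hu0, hu⟩ := ih (by omega)
    let u' : Fin (k + 1) → E := Function.update u ⟨m + 1, by omega⟩
      (z (m + 1) - (zComp Γ u (m + 1) - entry u (m + 1)))
    have hlt : ∀ j ≤ m, entry u' j = entry u j := by
      intro j hj
      rw [entry_of_le _ (by omega), entry_of_le _ (by omega)]
      exact Function.update_of_ne (by simp [Fin.ext_iff]; omega) _ _
    have heq : entry u' (m + 1) = z (m + 1) - (zComp Γ u (m + 1) - entry u (m + 1)) := by
      rw [entry_of_le _ hm]
      exact Function.update_self _ _ _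
    refine ⟨u', by rw [hlt 0 (by omega), hu0], fun i h1 hi => ?_⟩
    rcases Nat.lt_or_ge m i with h | h
    · obtain rfl : i = m + 1 := by omega
      have := zComp_sub_entry_congr Γ (show 1 ≤ m + 1 by omega) u' u fun j hj =>
        hlt j (by omega)
      rw [← this] at heq
      rw [← sub_eq_zero] at heq ⊢
      rw [← heq]
      abel
    · rw [zComp_congr Γ i u' u fun j hj => hlt j (by omega), hu i h1 h]

theorem exists_jetCurve_eq (u : Fin (k + 1) → E) :
    ∃ c : ℝ → E, ContDiff ℝ ∞ c ∧ jetCurve k c 0 = u := by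
  refine ⟨fun t => ∑ j : Fin (k + 1), t ^ (j : ℕ) • u j, by fun_prop, ?_⟩
  funext i
  have hd : ∀ j : Fin (k + 1), ContDiffAt ℝ ((i : ℕ) : WithTop ℕ∞) (fun t : ℝ => t ^ (j : ℕ)) 0 :=
    fun j => by fun_prop
  rw [jetCurve, iteratedDeriv_fun_sum (f := fun (j : Fin (k + 1)) (t : ℝ) => t ^ (j : ℕ) • u j)
    fun j _ => (hd j).smul contDiffAt_const]
  simp only [iteratedDeriv_smul_const (hd _), iteratedDeriv_fun_pow_zero]
  rw [Finset.sum_eq_single i (fun j _ hj => by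
    simp [Fin.val_ne_of_ne (Ne.symm hj)]) (fun h => absurd (Finset.mem_univ i) h)]
  have : (Nat.factorial i : ℝ) ≠ 0 := by exact_mod_cast Nat.factorial_ne_zero i
  simp [this]

end Triangular

/-! ### Tangent maps of locally smooth maps. -/

section TangentMaps

variable {F : Type*} [NormedAddCommGroup F] [NormedSpace ℝ F] {H : Type*} [TopologicalSpace H]
  {I : ModelWithCorners ℝ F H} {P : Type*} [TopologicalSpace P] [ChartedSpace H P]
  {F' : Type*} [NormedAddCommGroup F'] [NormedSpace ℝ F'] {H' : Type*} [TopologicalSpace H']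
  {I' : ModelWithCorners ℝ F' H'} {P' : Type*} [TopologicalSpace P'] [ChartedSpace H' P']

/-- Charts and their inverses are smooth only on an open set, so the result is transferred from
`tangentMapWithin`, which agrees with `tangentMap` there. -/
theorem contMDiffAt_tangentMap [IsManifold I 1 P] [IsManifold I' 1 P'] {f : P → P'} {U : Set P}
    (hU : IsOpen U) (hf : ContMDiffOn I I' ∞ f U) (p : TangentBundle I P) (hp : p.1 ∈ U) :
    ContMDiffAt I.tangent I'.tangent ∞ (tangentMap I I' f) p := by
  have h := hf.contMDiffOn_tangentMapWithin (m := ∞) (by simp) hU.uniqueMDiffOn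
  have hV : IsOpen (Bundle.TotalSpace.proj ⁻¹' U : Set (TangentBundle I P)) :=
    hU.preimage (FiberBundle.continuous_proj F (TangentSpace I))
  refine (h.contMDiffAt (hV.mem_nhds hp)).congr_of_eventuallyEq ?_
  filter_upwards [hV.mem_nhds hp] with q hq
  exact (tangentMapWithin_eq_tangentMap (hU.uniqueMDiffOn _ hq)
    ((hf.contMDiffAt (hU.mem_nhds hq)).mdifferentiableAt (by simp))).symm

theorem tangentMap_congr_of_eventuallyEq {f f₁ : P → P'} {p : TangentBundle I P}
    (h : f =ᶠ[𝓝 p.1] f₁) : tangentMap I I' f p = tangentMap I I' f₁ p := by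
  refine Bundle.TotalSpace.ext h.eq_of_nhds ?_
  simp only [tangentMap]
  rw [h.mfderiv_eq]
  rfl

theorem contMDiff_tangentBundle_mk :
    ContMDiff 𝓘(ℝ, F × F) 𝓘(ℝ, F).tangent ∞
      (fun q : F × F => (⟨q.1, q.2⟩ : TangentBundle 𝓘(ℝ, F) F)) := by
  intro q
  apply Bundle.contMDiffAt_totalSpace.2
  refine ⟨contDiff_fst.contMDiff.contMDiffAt, ?_⟩
  exact (contDiff_snd (𝕜 := ℝ) (E := F) (F := F)
    (n := ∞)).contMDiff.contMDiffAt.congr_of_eventuallyEq (Eventually.of_forall fun q => by simp)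

end TangentMaps

/-! ### Smoothness and linearity of the Christoffel symbols. -/

section Charts

variable {E : Type*} [NormedAddCommGroup E] [NormedSpace ℝ E]
  {M : Type*} [TopologicalSpace M] [ChartedSpace E M] [IsManifold 𝓘(ℝ, E) ∞ M]
  {φ : OpenPartialHomeomorph M E}

/-- The principal part of `Tφ : TM → TE`. -/
def tangentPart (φ : OpenPartialHomeomorph M E) (p : TM E M) : E :=
  mfderiv 𝓘(ℝ, E) 𝓘(ℝ, E) φ p.1 p.2

theorem contMDiffAt_tangentPart (hφ : φ ∈ IsManifold.maximalAtlas 𝓘(ℝ, E) ∞ M) (p : TM E M)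
    (hp : p.1 ∈ φ.source) : ContMDiffAt 𝓘(ℝ, E).tangent 𝓘(ℝ, E) ∞ (tangentPart φ) p :=
  (contMDiff_snd_tangentBundle_modelSpace E 𝓘(ℝ, E)).contMDiffAt.comp p
    (contMDiffAt_tangentMap φ.open_source (contMDiffOn_of_mem_maximalAtlas hφ) p hp)

theorem contMDiffAt_tangentChartSymm (hφ : φ ∈ IsManifold.maximalAtlas 𝓘(ℝ, E) ∞ M) (q : E × E)
    (hq : q.1 ∈ φ.target) :
    ContMDiffAt 𝓘(ℝ, E × E) 𝓘(ℝ, E).tangent ∞ (tangentChartSymm φ) q :=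
  (contMDiffAt_tangentMap φ.open_target (contMDiffOn_symm_of_mem_maximalAtlas hφ) ⟨q.1, q.2⟩
    hq).comp q contMDiff_tangentBundle_mk.contMDiffAt

/-- The symbol is a composite of smooth maps: the inclusion of `(x, ξ; y, 0)`, the tangent map of
`tangentChartSymm φ`, the connection map `K`, and the principal part of `Tφ`. -/
theorem contDiffAt_christoffel (D : LinearConnection E M)
    (hφ : φ ∈ IsManifold.maximalAtlas 𝓘(ℝ, E) ∞ M) {x : E} (hx : x ∈ φ.target) (ξ y : E) :
    ContDiffAt ℝ ∞ (fun q : E × E × E => D.christoffel φ q.1 q.2.1 q.2.2) (x, ξ, y) := by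
  have hW : ContMDiffAt 𝓘(ℝ, E × E × E) 𝓘(ℝ, E × E).tangent ∞ (fun q : E × E × E =>
      (⟨(q.1, q.2.1), (q.2.2, (0 : E))⟩ : TangentBundle 𝓘(ℝ, E × E) (E × E))) (x, ξ, y) := by
    have h : ContDiff ℝ ∞ (fun q : E × E × E => ((q.1, q.2.1), (q.2.2, (0 : E)))) := by fun_prop
    exact (contMDiff_tangentBundle_mk (F := E × E)).contMDiffAt.comp _ h.contMDiff.contMDiffAt
  have hT := contMDiffAt_tangentMap (I := 𝓘(ℝ, E × E)) (I' := 𝓘(ℝ, E).tangent)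
    (f := tangentChartSymm φ) (φ.open_target.prod (isOpen_univ (X := E)))
    (fun q hq => (contMDiffAt_tangentChartSymm hφ q hq.1).contMDiffWithinAt)
    ⟨(x, ξ), (y, (0 : E))⟩ ⟨hx, trivial⟩
  have hK : ContMDiff 𝓘(ℝ, E).tangent.tangent 𝓘(ℝ, E).tangent ∞ D.K := D.smooth
  have hP := contMDiffAt_tangentPart hφ (D.K (tangentMap 𝓘(ℝ, E × E) 𝓘(ℝ, E).tangent
      (tangentChartSymm φ) ⟨(x, ξ), (y, (0 : E))⟩)) (φ.map_target hx)
  exact (hP.comp (x, ξ, y) (hK.contMDiffAt.comp (x, ξ, y) (hT.comp (x, ξ, y) hW))).contDiffAt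

theorem isLocalConnection_christoffel (D : LinearConnection E M)
    (hφ : φ ∈ IsManifold.maximalAtlas 𝓘(ℝ, E) ∞ M) :
    IsLocalConnection (D.christoffel φ) φ.target where
  isOpen := φ.open_target
  smooth _ hx ξ y := contDiffAt_christoffel D hφ hx ξ y
  linear x _ ξ := by
    let A : E × E →L[ℝ] TangentSpace 𝓘(ℝ, E).tangent (tangentChartSymm φ (x, ξ)) :=
      mfderiv 𝓘(ℝ, E × E) 𝓘(ℝ, E).tangent (tangentChartSymm φ) (x, ξ)
    let B : TangentSpace 𝓘(ℝ, E) (φ.symm x) →L[ℝ] E := mfderiv 𝓘(ℝ, E) 𝓘(ℝ, E) φ (φ.symm x)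
    let C : E →L[ℝ] E := B.comp ((D.fiberMap (tangentChartSymm φ (x, ξ))).comp
      (A.comp (ContinuousLinearMap.inl ℝ E E)))
    exact C.toLinearMap.isLinear

end Charts

/-! ### Local representatives of maps between manifolds. -/

section LocalRepresentative

variable {E M E' N : Type*} [TopologicalSpace E] [TopologicalSpace M] [TopologicalSpace E']
  [TopologicalSpace N] {φ : OpenPartialHomeomorph M E} {ψ : OpenPartialHomeomorph N E'} {g : M → N}

/-- The local representative `ψ ∘ g ∘ φ⁻¹`. -/
def localRep (φ : OpenPartialHomeomorph M E) (ψ : OpenPartialHomeomorph N E') (g : M → N) (x : E) :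
    E' := ψ (g (φ.symm x))

/-- The domain of the local representative. -/
def localDom (φ : OpenPartialHomeomorph M E) (ψ : OpenPartialHomeomorph N E') (g : M → N) :
    Set E := φ '' (φ.source ∩ g ⁻¹' ψ.source)

theorem mem_localDom {x : E} :
    x ∈ localDom φ ψ g ↔ x ∈ φ.target ∧ g (φ.symm x) ∈ ψ.source := by
  constructor
  · rintro ⟨p, ⟨hp, hg⟩, rfl⟩
    exact ⟨φ.map_source hp, by rwa [φ.left_inv hp]⟩
  · rintro ⟨hx, hg⟩
    exact ⟨φ.symm x, ⟨φ.map_target hx, hg⟩, φ.right_inv hx⟩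

theorem isOpen_localDom (hg : Continuous g) : IsOpen (localDom φ ψ g) := by
  have : localDom φ ψ g = φ.target ∩ φ.symm ⁻¹' (g ⁻¹' ψ.source) := by
    ext x; exact mem_localDom
  rw [this]
  exact φ.symm.isOpen_inter_preimage (ψ.open_source.preimage hg)

end LocalRepresentative

section Charts

variable {E : Type*} [NormedAddCommGroup E] [NormedSpace ℝ E]
  {M : Type*} [TopologicalSpace M] [ChartedSpace E M] {φ : OpenPartialHomeomorph M E}
  {E' : Type*} [NormedAddCommGroup E'] [NormedSpace ℝ E']
  {N : Type*} [TopologicalSpace N] [ChartedSpace E' N] {ψ : OpenPartialHomeomorph N E'} {g : M → N}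

theorem mfderiv_mfderiv_symm_of_mem_maximalAtlas (hφ : φ ∈ IsManifold.maximalAtlas 𝓘(ℝ, E) ∞ M) {x : E}
    (hx : x ∈ φ.target) (η : E) :
    mfderiv 𝓘(ℝ, E) 𝓘(ℝ, E) φ (φ.symm x) (mfderiv 𝓘(ℝ, E) 𝓘(ℝ, E) φ.symm x η) = η := by
  have h1 : MDifferentiableAt 𝓘(ℝ, E) 𝓘(ℝ, E) φ (φ.symm x) :=
    (contMDiffAt_of_mem_maximalAtlas hφ (φ.map_target hx)).mdifferentiableAt (by simp)
  have h2 : MDifferentiableAt 𝓘(ℝ, E) 𝓘(ℝ, E) φ.symm x :=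
    (contMDiffAt_symm_of_mem_maximalAtlas hφ hx).mdifferentiableAt (by simp)
  refine (mfderiv_comp_apply x h1 h2 η).symm.trans ?_
  have : (φ ∘ φ.symm) =ᶠ[𝓝 x] id := by
    filter_upwards [φ.open_target.mem_nhds hx] with z hz using φ.right_inv hz
  rw [this.mfderiv_eq, mfderiv_id]
  rfl

theorem contDiffAt_localRep (hφ : φ ∈ IsManifold.maximalAtlas 𝓘(ℝ, E) ∞ M)
    (hψ : ψ ∈ IsManifold.maximalAtlas 𝓘(ℝ, E') ∞ N) (hg : ContMDiff 𝓘(ℝ, E) 𝓘(ℝ, E') ∞ g)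
    {x : E} (hx : x ∈ localDom φ ψ g) : ContDiffAt ℝ ∞ (localRep φ ψ g) x := by
  rw [mem_localDom] at hx
  have a1 := contMDiffAt_symm_of_mem_maximalAtlas hφ hx.1
  have a3 := contMDiffAt_of_mem_maximalAtlas hψ hx.2
  exact (a3.comp x (hg.contMDiffAt.comp x a1)).contDiffAt

end Charts

/-! ### Transformation law of the Christoffel symbols. -/

section Law

variable {E : Type*} [NormedAddCommGroup E] [NormedSpace ℝ E]
  {M : Type*} [TopologicalSpace M] [ChartedSpace E M] [IsManifold 𝓘(ℝ, E) ∞ M]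
  {φ : OpenPartialHomeomorph M E}

/-- Differentiate the identity that `(Tφ)⁻¹` covers `φ⁻¹`. -/
theorem dProj_mfderiv_tangentChartSymm (hφ : φ ∈ IsManifold.maximalAtlas 𝓘(ℝ, E) ∞ M) (q : E × E)
    (hq : q.1 ∈ φ.target) (y η : E) :
    dProj E (tangentChartSymm φ q)
      (mfderiv 𝓘(ℝ, E × E) 𝓘(ℝ, E).tangent (tangentChartSymm φ) q (y, η))
      = mfderiv 𝓘(ℝ, E) 𝓘(ℝ, E) φ.symm q.1 y := by
  have h1 : MDifferentiableAt 𝓘(ℝ, E × E) 𝓘(ℝ, E).tangent (tangentChartSymm φ) q :=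
    (contMDiffAt_tangentChartSymm hφ q hq).mdifferentiableAt (by simp)
  have h2 : MDifferentiableAt 𝓘(ℝ, E).tangent 𝓘(ℝ, E) (fun p : TM E M => p.proj)
      (tangentChartSymm φ q) :=
    (Bundle.contMDiff_proj (n := 1) (IB := 𝓘(ℝ, E)) (F := E)
      (TangentSpace 𝓘(ℝ, E) : M → Type _)).contMDiffAt.mdifferentiableAt (by simp)
  have h3 : MDifferentiableAt 𝓘(ℝ, E × E) 𝓘(ℝ, E) (Prod.fst : E × E → E) q :=
    (contDiff_fst (𝕜 := ℝ) (n := ∞)).contMDiff.contMDiffAt.mdifferentiableAt (by simp)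
  have h4 : MDifferentiableAt 𝓘(ℝ, E) 𝓘(ℝ, E) φ.symm q.1 :=
    (contMDiffAt_symm_of_mem_maximalAtlas hφ hq).mdifferentiableAt (by simp)
  have e1 := mfderiv_comp_apply q h2 h1 ((y, η) : E × E)
  have e2 := mfderiv_comp_apply q h4 h3 ((y, η) : E × E)
  have e3 : (fun p : TM E M => p.proj) ∘ tangentChartSymm φ = φ.symm ∘ Prod.fst := rfl
  rw [e3] at e1
  rw [dProj, ← e1, e2, mfderiv_eq_fderiv, fderiv_fst]
  rfl

/-- Since `(Tφ)⁻¹` is linear on fibres, it carries the line `t ↦ (x, ξ + t η)` to the line in the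
fibre of `TM` that defines the vertical lift. -/
theorem verticalLift_tangentChartSymm (hφ : φ ∈ IsManifold.maximalAtlas 𝓘(ℝ, E) ∞ M) (q : E × E)
    (hq : q.1 ∈ φ.target) (η : E) :
    verticalLift E (tangentChartSymm φ q) (mfderiv 𝓘(ℝ, E) 𝓘(ℝ, E) φ.symm q.1 η)
      = mfderiv 𝓘(ℝ, E × E) 𝓘(ℝ, E).tangent (tangentChartSymm φ) q ((0 : E), η) := by
  have h1 : MDifferentiableAt 𝓘(ℝ, E × E) 𝓘(ℝ, E).tangent (tangentChartSymm φ) q :=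
    (contMDiffAt_tangentChartSymm hφ q hq).mdifferentiableAt (by simp)
  have hl : HasFDerivAt (fun t : ℝ => (q.1, q.2 + t • η))
      ((0 : ℝ →L[ℝ] E).prod ((ContinuousLinearMap.id ℝ ℝ).smulRight η)) 0 :=
    (hasFDerivAt_const q.1 (0 : ℝ)).prodMk
      (((hasFDerivAt_id (𝕜 := ℝ) (0 : ℝ)).smul_const η).const_add q.2)
  have h2 : MDifferentiableAt 𝓘(ℝ, ℝ) 𝓘(ℝ, E × E) (fun t : ℝ => (q.1, q.2 + t • η)) 0 :=
    hl.differentiableAt.mdifferentiableAt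
  have h0 : (fun t : ℝ => (q.1, q.2 + t • η)) 0 = q := by simp
  have e1 := mfderiv_comp_apply_of_eq (0 : ℝ) h1 h2 h0 (1 : ℝ)
  let L : E →L[ℝ] E := mfderiv 𝓘(ℝ, E) 𝓘(ℝ, E) φ.symm q.1
  have e2 : (fun t : ℝ => (⟨φ.symm q.1, (L q.2 + t • L η : E)⟩ : TM E M))
      = tangentChartSymm φ ∘ (fun t : ℝ => (q.1, q.2 + t • η)) := by
    funext t
    refine Bundle.TotalSpace.ext rfl (heq_of_eq ?_)
    change L q.2 + t • L η = L (q.2 + t • η)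
    rw [map_add, map_smul]
  change mfderiv 𝓘(ℝ, ℝ) 𝓘(ℝ, E).tangent
    (fun t : ℝ => (⟨φ.symm q.1, (L q.2 + t • L η : E)⟩ : TM E M)) 0 (1 : ℝ) = _
  rw [e2]
  refine e1.trans ?_
  rw [mfderiv_eq_fderiv, hl.fderiv]
  have e3 : ((0 : ℝ →L[ℝ] E).prod ((ContinuousLinearMap.id ℝ ℝ).smulRight η)) (1 : ℝ)
      = ((0 : E), η) := by simp
  exact congrArg _ e3

/-- In a chart, `K` is `(x, ξ; y, η) ↦ (x, η + Γ_φ(x, ξ) y)`. -/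
theorem tangentPart_K (D : LinearConnection E M)
    (hφ : φ ∈ IsManifold.maximalAtlas 𝓘(ℝ, E) ∞ M) {x : E} (hx : x ∈ φ.target) (ξ y η : E) :
    tangentPart φ (D.K (tangentMap 𝓘(ℝ, E × E) 𝓘(ℝ, E).tangent
      (tangentChartSymm φ) ⟨(x, ξ), (y, η)⟩)) = η + D.christoffel φ x ξ y := by
  let A : E × E →L[ℝ] TangentSpace 𝓘(ℝ, E).tangent (tangentChartSymm φ (x, ξ)) :=
    mfderiv 𝓘(ℝ, E × E) 𝓘(ℝ, E).tangent (tangentChartSymm φ) (x, ξ)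
  let B : TangentSpace 𝓘(ℝ, E) (φ.symm x) →L[ℝ] E := mfderiv 𝓘(ℝ, E) 𝓘(ℝ, E) φ (φ.symm x)
  let C : E × E →L[ℝ] E := B.comp ((D.fiberMap (tangentChartSymm φ (x, ξ))).comp A)
  -- In coordinates `J` sends `(η, 0)` to `(0, η)`, so `K ∘ J = (π_M)_*` at `(η, 0)` determines `K`
  -- on vertical vectors.
  have hv : D.fiberMap (tangentChartSymm φ (x, ξ)) (A (0, η))
      = mfderiv 𝓘(ℝ, E) 𝓘(ℝ, E) φ.symm x η := by
    have h := D.vertical (tangentChartSymm φ (x, ξ)) (A (η, 0))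
    rw [vertEndo] at h
    have h1 : dProj E (tangentChartSymm φ (x, ξ)) (A (η, 0))
      = mfderiv 𝓘(ℝ, E) 𝓘(ℝ, E) φ.symm x η := dProj_mfderiv_tangentChartSymm hφ (x, ξ) hx η 0
    rw [h1] at h
    exact (congrArg _ (verticalLift_tangentChartSymm hφ (x, ξ) hx η)).symm.trans h
  have h0 : C (0, η) = η := (congrArg B hv).trans (mfderiv_mfderiv_symm_of_mem_maximalAtlas hφ hx η)
  change C (y, η) = η + C (y, 0)
  rw [show ((y, η) : E × E) = (0, η) + (y, 0) by simp, map_add, h0]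

variable {E' : Type*} [NormedAddCommGroup E'] [NormedSpace ℝ E']
  {N : Type*} [TopologicalSpace N] [ChartedSpace E' N] [IsManifold 𝓘(ℝ, E') ∞ N]
  {ψ : OpenPartialHomeomorph N E'} {g : M → N}

omit [IsManifold 𝓘(ℝ, E) ∞ M] [IsManifold 𝓘(ℝ, E') ∞ N] in
/-- `Tg` read in charts. -/
theorem tangentPart_tangentMap (hφ : φ ∈ IsManifold.maximalAtlas 𝓘(ℝ, E) ∞ M)
    (hψ : ψ ∈ IsManifold.maximalAtlas 𝓘(ℝ, E') ∞ N) (hg : ContMDiff 𝓘(ℝ, E) 𝓘(ℝ, E') ∞ g)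
    (p : TM E M) (hp : p.1 ∈ φ.source) (hgp : g p.1 ∈ ψ.source) :
    tangentPart ψ (tangentMap 𝓘(ℝ, E) 𝓘(ℝ, E') g p)
      = fderiv ℝ (localRep φ ψ g) (φ p.1) (tangentPart φ p) := by
  have hx : φ p.1 ∈ localDom φ ψ g := ⟨p.1, ⟨hp, hgp⟩, rfl⟩
  have h1 : MDifferentiableAt 𝓘(ℝ, E) 𝓘(ℝ, E') g p.1 :=
    hg.contMDiffAt.mdifferentiableAt (by simp)
  have h2 : MDifferentiableAt 𝓘(ℝ, E') 𝓘(ℝ, E') ψ (g p.1) :=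
    (contMDiffAt_of_mem_maximalAtlas hψ hgp).mdifferentiableAt (by simp)
  have h3 : MDifferentiableAt 𝓘(ℝ, E) 𝓘(ℝ, E) φ p.1 :=
    (contMDiffAt_of_mem_maximalAtlas hφ hp).mdifferentiableAt (by simp)
  have h4 : MDifferentiableAt 𝓘(ℝ, E) 𝓘(ℝ, E') (localRep φ ψ g) (φ p.1) :=
    ((contDiffAt_localRep hφ hψ hg hx).differentiableAt (by simp)).mdifferentiableAt
  have he : ψ ∘ g =ᶠ[𝓝 p.1] localRep φ ψ g ∘ φ := by
    filter_upwards [φ.open_source.mem_nhds hp] with z hz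
    simp [localRep, φ.left_inv hz]
  have e1 := mfderiv_comp_apply p.1 h2 h1 p.2
  have e2 := mfderiv_comp_apply p.1 h4 h3 p.2
  rw [he.mfderiv_eq] at e1
  rw [← mfderiv_eq_fderiv]
  exact e1.symm.trans e2

omit [IsManifold 𝓘(ℝ, E) ∞ M] [IsManifold 𝓘(ℝ, E') ∞ N] in
theorem tangentMap_comp_tangentChartSymm (hφ : φ ∈ IsManifold.maximalAtlas 𝓘(ℝ, E) ∞ M)
    (hψ : ψ ∈ IsManifold.maximalAtlas 𝓘(ℝ, E') ∞ N) (hg : ContMDiff 𝓘(ℝ, E) 𝓘(ℝ, E') ∞ g)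
    {q : E × E} (hq : q.1 ∈ localDom φ ψ g) :
    tangentMap 𝓘(ℝ, E) 𝓘(ℝ, E') g (tangentChartSymm φ q)
      = tangentChartSymm ψ (localRep φ ψ g q.1, fderiv ℝ (localRep φ ψ g) q.1 q.2) := by
  have hq' := mem_localDom.1 hq
  have h1 : MDifferentiableAt 𝓘(ℝ, E) 𝓘(ℝ, E') g (φ.symm q.1) :=
    hg.contMDiffAt.mdifferentiableAt (by simp)
  have h2 : MDifferentiableAt 𝓘(ℝ, E') 𝓘(ℝ, E') ψ.symm (localRep φ ψ g q.1) :=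
    (contMDiffAt_symm_of_mem_maximalAtlas hψ (ψ.map_source hq'.2)).mdifferentiableAt (by simp)
  have h3 : MDifferentiableAt 𝓘(ℝ, E) 𝓘(ℝ, E) φ.symm q.1 :=
    (contMDiffAt_symm_of_mem_maximalAtlas hφ hq'.1).mdifferentiableAt (by simp)
  have h4 : MDifferentiableAt 𝓘(ℝ, E) 𝓘(ℝ, E') (localRep φ ψ g) q.1 :=
    ((contDiffAt_localRep hφ hψ hg hq).differentiableAt (by simp)).mdifferentiableAt
  have he : g ∘ φ.symm =ᶠ[𝓝 q.1] ψ.symm ∘ localRep φ ψ g := by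
    filter_upwards [(isOpen_localDom hg.continuous).mem_nhds hq] with z hz
    simp [localRep, ψ.left_inv (mem_localDom.1 hz).2]
  let W : TangentBundle 𝓘(ℝ, E) E := ⟨q.1, q.2⟩
  have e1 := tangentMap_comp_at W h1 h3
  have e2 := tangentMap_comp_at W h2 h4
  rw [tangentMap_congr_of_eventuallyEq (p := W) he, e2] at e1
  refine e1.symm.trans ?_
  rw [← mfderiv_eq_fderiv]
  rfl

/-- The transformation law of the local components of `g`-related connections. -/
theorem christoffel_related {DM : LinearConnection E M} {DN : LinearConnection E' N}
    (hφ : φ ∈ IsManifold.maximalAtlas 𝓘(ℝ, E) ∞ M)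
    (hψ : ψ ∈ IsManifold.maximalAtlas 𝓘(ℝ, E') ∞ N) (hg : ContMDiff 𝓘(ℝ, E) 𝓘(ℝ, E') ∞ g)
    (hR : Related g DM DN) {x : E} (hx : x ∈ localDom φ ψ g) (ξ y : E) :
    fderiv ℝ (fderiv ℝ (localRep φ ψ g)) x y ξ
      + DN.christoffel ψ (localRep φ ψ g x) (fderiv ℝ (localRep φ ψ g) x ξ)
          (fderiv ℝ (localRep φ ψ g) x y)
      = fderiv ℝ (localRep φ ψ g) x (DM.christoffel φ x ξ y) := by
  have hx' := mem_localDom.1 hx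
  set τ := localRep φ ψ g with hτdef
  have hτ : ContDiffAt ℝ ∞ τ x := contDiffAt_localRep hφ hψ hg hx
  -- `T` is `Tg` in coordinates. Its derivative at `(x, ξ)` in the direction `(y, 0)` has second
  -- component `D²τ(x)(y, ξ)`, the inhomogeneous term of the law.
  let T : E × E → E' × E' := fun q => (τ q.1, fderiv ℝ τ q.1 q.2)
  have hT : HasFDerivAt T (((fderiv ℝ τ x).comp (ContinuousLinearMap.fst ℝ E E)).prod
      ((fderiv ℝ τ x).comp (ContinuousLinearMap.snd ℝ E E)
        + ((fderiv ℝ (fderiv ℝ τ) x).comp (ContinuousLinearMap.fst ℝ E E)).flip ξ)) (x, ξ) := by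
    have d1 : HasFDerivAt (fun q : E × E => τ q.1) _ (x, ξ) :=
      HasFDerivAt.comp (g := τ) (x, ξ) (hτ.differentiableAt (by simp)).hasFDerivAt hasFDerivAt_fst
    have d2 : HasFDerivAt (fun q : E × E => fderiv ℝ τ q.1) _ (x, ξ) :=
      ((hτ.fderiv_right (m := ∞) (by simp)).differentiableAt (by simp)).hasFDerivAt.comp (x, ξ)
        hasFDerivAt_fst
    exact d1.prodMk (d2.clm_apply hasFDerivAt_snd)
  let W : TangentBundle 𝓘(ℝ, E × E) (E × E) := ⟨(x, ξ), (y, (0 : E))⟩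
  have hTW : tangentMap 𝓘(ℝ, E × E) 𝓘(ℝ, E' × E') T W
      = ⟨(τ x, fderiv ℝ τ x ξ), (fderiv ℝ τ x y, fderiv ℝ (fderiv ℝ τ) x y ξ)⟩ := by
    rw [tangentMap, mfderiv_eq_fderiv]
    refine Bundle.TotalSpace.ext rfl (heq_of_eq ?_)
    change fderiv ℝ T (x, ξ) (y, 0) = _
    rw [hT.fderiv]
    simp
  have hgT : ContMDiff 𝓘(ℝ, E).tangent 𝓘(ℝ, E').tangent ∞ (tangentMap 𝓘(ℝ, E) 𝓘(ℝ, E') g) :=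
    hg.contMDiff_tangentMap (by simp)
  have he : tangentMap 𝓘(ℝ, E) 𝓘(ℝ, E') g ∘ tangentChartSymm φ
      =ᶠ[𝓝 ((x, ξ) : E × E)] tangentChartSymm ψ ∘ T := by
    have : ∀ᶠ q : E × E in 𝓝 (x, ξ), q.1 ∈ localDom φ ψ g :=
      continuous_fst.continuousAt.eventually ((isOpen_localDom hg.continuous).mem_nhds hx)
    filter_upwards [this] with q hq
    exact tangentMap_comp_tangentChartSymm hφ hψ hg hq
  have h1 : MDifferentiableAt 𝓘(ℝ, E).tangent 𝓘(ℝ, E').tangent (tangentMap 𝓘(ℝ, E) 𝓘(ℝ, E') g)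
      (tangentChartSymm φ W.1) := hgT.contMDiffAt.mdifferentiableAt (by simp)
  have h2 : MDifferentiableAt 𝓘(ℝ, E × E) 𝓘(ℝ, E).tangent (tangentChartSymm φ) W.1 :=
    (contMDiffAt_tangentChartSymm hφ _ hx'.1).mdifferentiableAt (by simp)
  have h3 : MDifferentiableAt 𝓘(ℝ, E' × E') 𝓘(ℝ, E').tangent (tangentChartSymm ψ) (T W.1) :=
    (contMDiffAt_tangentChartSymm hψ _ (ψ.map_source hx'.2)).mdifferentiableAt (by simp)
  have h4 : MDifferentiableAt 𝓘(ℝ, E × E) 𝓘(ℝ, E' × E') T W.1 :=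
    hT.differentiableAt.mdifferentiableAt
  have key := hR (tangentMap 𝓘(ℝ, E × E) 𝓘(ℝ, E).tangent (tangentChartSymm φ) W)
  rw [← tangentMap_comp_at W h1 h2, tangentMap_congr_of_eventuallyEq (p := W) he,
    tangentMap_comp_at W h3 h4, hTW] at key
  have key2 := congrArg (tangentPart ψ) key
  rw [tangentPart_K DN hψ (x := τ x) (ψ.map_source hx'.2), tangentPart_tangentMap hφ hψ hg _
    (φ.map_target hx'.1) hx'.2] at key2
  refine key2.trans ?_
  have e : φ (φ.symm x) = x := φ.right_inv hx'.1
  change fderiv ℝ τ (φ (φ.symm x)) (DM.christoffel φ x ξ y) = _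
  rw [e]

end Law

/-! ### Diagonal action of a linear map on `E^k`. -/

section DiagonalMaps

variable {E : Type*} [NormedAddCommGroup E] [NormedSpace ℝ E]
  {E' : Type*} [NormedAddCommGroup E'] [NormedSpace ℝ E']

/-- The map `E^k → E'^k` that applies `A` to every entry. -/
def diagMap (k : ℕ) (A : E →L[ℝ] E') : (Fin k → E) →L[ℝ] (Fin k → E') :=
  ∑ i : Fin k, (ContinuousLinearMap.single ℝ (fun _ : Fin k => E') i).comp
    (A.comp (ContinuousLinearMap.proj i))

theorem diagMap_apply (k : ℕ) (A : E →L[ℝ] E') (v : Fin k → E) (i : Fin k) :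
    diagMap k A v i = A (v i) := by
  simp [diagMap, Pi.single_apply]

theorem contDiffAt_diagMap {G : Type*} [NormedAddCommGroup G] [NormedSpace ℝ G] (k : ℕ)
    {A : G → E →L[ℝ] E'} {x : G} (hA : ContDiffAt ℝ ∞ A x) :
    ContDiffAt ℝ ∞ (fun x => diagMap k (A x)) x := by
  unfold diagMap
  exact ContDiffAt.sum fun i _ => contDiffAt_const.clm_comp (hA.clm_comp contDiffAt_const)

end DiagonalMaps

/-! ### Jets of curves and `T^k g` in the trivializations. -/

section Jets

variable {E : Type*} [NormedAddCommGroup E] [NormedSpace ℝ E] {k : ℕ}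

theorem jetCurve_congr {c c' : ℝ → E} {t : ℝ} (h : c =ᶠ[𝓝 t] c') :
    jetCurve k c t = jetCurve k c' t := by
  funext j
  rw [jetCurve, jetCurve, h.iteratedDeriv_eq]

theorem entry_jetCurve_zero (c : ℝ → E) (t : ℝ) : entry (jetCurve k c t) 0 = c t := by
  rw [entry_jetCurve _ _ (Nat.zero_le _)]; simp

theorem iteratedDeriv_eq_of_jetCurve_eq {c c' : ℝ → E} {t : ℝ}
    (h : jetCurve k c t = jetCurve k c' t) {j : ℕ} (hj : j ≤ k) :
    iteratedDeriv j c t = iteratedDeriv j c' t := by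
  have h1 := congrArg (fun u => entry u j) h
  simp only [entry_jetCurve _ _ hj] at h1
  exact smul_right_injective E
    (inv_ne_zero (by exact_mod_cast Nat.factorial_ne_zero j : (Nat.factorial j : ℝ) ≠ 0)) h1

variable {M : Type*} [TopologicalSpace M] [ChartedSpace E M]

/-- The curve determines its base point, so equal curves give equal points even when `x` and `x'`
are only provably equal; this avoids transport between fibres. -/
theorem oscMk_eq {x x' : M} {γ : CurveAt E x} {δ : CurveAt E x'} (h : γ.toFun = δ.toFun) :
    oscMk E k x γ = oscMk E k x' δ := by
  obtain ⟨c, hc, hx⟩ := γ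
  obtain ⟨c', hc', hx'⟩ := δ
  obtain rfl : c = c' := h
  obtain rfl : x = x' := hx.symm.trans hx'
  rfl

theorem exists_oscMk_eq (p : Osc E M k) : ∃ γ : CurveAt E p.1, p = oscMk E k p.1 γ := by
  obtain ⟨x, q⟩ := p
  induction q using Quotient.inductionOn with
  | _ γ => exact ⟨γ, rfl⟩

theorem jetCoord_oscMk {φ : OpenPartialHomeomorph M E}
    (hφ : φ ∈ IsManifold.maximalAtlas 𝓘(ℝ, E) ∞ M) {x : M} (hx : x ∈ φ.source)
    (γ : CurveAt E x) :
    jetCoord k φ (oscMk E k x γ) = jetCurve k (fun t => φ (γ.toFun t)) 0 :=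
  if_pos ⟨hφ, hx⟩

variable [IsManifold 𝓘(ℝ, E) ∞ M]
  {E' : Type*} [NormedAddCommGroup E'] [NormedSpace ℝ E']
  {N : Type*} [TopologicalSpace N] [ChartedSpace E' N] [IsManifold 𝓘(ℝ, E') ∞ N]

theorem oscMap_oscMk {g : M → N} (hg : ContMDiff 𝓘(ℝ, E) 𝓘(ℝ, E') ∞ g) {x : M}
    (γ : CurveAt E x) : oscMap k g hg (oscMk E k x γ) = oscMk E' k (g x) (γ.map g hg) := rfl

theorem oscMap_leftInverse {g : M → N} {h : N → M} (hg : ContMDiff 𝓘(ℝ, E) 𝓘(ℝ, E') ∞ g)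
    (hh : ContMDiff 𝓘(ℝ, E') 𝓘(ℝ, E) ∞ h) (hgh : Function.LeftInverse h g) :
    Function.LeftInverse (oscMap k h hh) (oscMap k g hg) := by
  intro p
  obtain ⟨γ, hγ⟩ := exists_oscMk_eq p
  rw [hγ, oscMap_oscMk, oscMap_oscMk]
  exact oscMk_eq (funext fun t => hgh _)

theorem oscMap_id (p : Osc E M k) : oscMap k id contMDiff_id p = p := by
  obtain ⟨γ, hγ⟩ := exists_oscMk_eq p
  rw [hγ, oscMap_oscMk]
  exact oscMk_eq rfl

/-- In the trivializations, `T^k g` acts on every fibre component by the derivative of the local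
representative of `g`. -/
theorem oscTriv_oscMap {DM : LinearConnection E M} {DN : LinearConnection E' N} {g : M → N}
    (hg : ContMDiff 𝓘(ℝ, E) 𝓘(ℝ, E') ∞ g) (hR : Related g DM DN)
    {φ : OpenPartialHomeomorph M E} (hφ : φ ∈ IsManifold.maximalAtlas 𝓘(ℝ, E) ∞ M)
    {ψ : OpenPartialHomeomorph N E'} (hψ : ψ ∈ IsManifold.maximalAtlas 𝓘(ℝ, E') ∞ N)
    {p : Osc E M k} (hp : p.1 ∈ φ.source) (hgp : g p.1 ∈ ψ.source) :
    (oscTriv DN k ψ (oscMap k g hg p)).2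
      = diagMap k (fderiv ℝ (localRep φ ψ g) (φ p.1)) (oscTriv DM k φ p).2 := by
  obtain ⟨γ, hγ⟩ := exists_oscMk_eq p
  obtain ⟨ε, hε, hs⟩ := γ.smooth
  set V : Set M := φ.source ∩ g ⁻¹' ψ.source with hV
  have hVo : IsOpen V := φ.open_source.inter (ψ.open_source.preimage hg.continuous)
  -- The times at which the curve is smooth and lies in both chart domains: the open set on which
  -- `zComp_map` runs its induction.
  have hI : IsOpen (Ioo (-ε) ε ∩ γ.toFun ⁻¹' V) :=
    hs.continuousOn.isOpen_inter_preimage isOpen_Ioo hVo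
  have h0 : (0 : ℝ) ∈ Ioo (-ε) ε ∩ γ.toFun ⁻¹' V :=
    ⟨⟨by linarith, hε⟩, by rw [mem_preimage, γ.map_zero]; exact ⟨hp, hgp⟩⟩
  funext i
  rw [diagMap_apply]
  simp only [oscTriv]
  rw [hγ, oscMap_oscMk, jetCoord_oscMk hφ hp, jetCoord_oscMk hψ hgp]
  have he : (fun t => ψ ((γ.map g hg).toFun t)) =ᶠ[𝓝 0]
      fun t => localRep φ ψ g (φ (γ.toFun t)) := by
    filter_upwards [hI.mem_nhds h0] with t ht
    simp [CurveAt.map, localRep, φ.left_inv ht.2.1]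
  rw [jetCurve_congr he]
  have key := zComp_map (k := k) (isLocalConnection_christoffel DM hφ)
    (isLocalConnection_christoffel DN hψ) (τ := localRep φ ψ g) (o := localDom φ ψ g)
    (fun x hx => (mem_localDom.1 hx).1) (fun x hx => contDiffAt_localRep hφ hψ hg hx)
    (fun x hx => ψ.map_source (mem_localDom.1 hx).2)
    (fun x hx ξ y => christoffel_related hφ hψ hg hR hx ξ y) hI
    (c := fun t => φ (γ.toFun t))
    (fun t ht => ((contMDiffAt_of_mem_maximalAtlas hφ ht.2.1).comp t
      (hs.contMDiffAt (isOpen_Ioo.mem_nhds ht.1))).contDiffAt)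
    (fun t ht => ⟨γ.toFun t, ht.2, rfl⟩) (i := (i : ℕ) + 1) (by omega) (by omega) 0 h0
  simp only [γ.map_zero] at key
  exact key

end Jets

/-! ### Relatedness under the identity and under inverses. -/

section Related

variable {E : Type*} [NormedAddCommGroup E] [NormedSpace ℝ E]
  {M : Type*} [TopologicalSpace M] [ChartedSpace E M] [IsManifold 𝓘(ℝ, E) ∞ M]
  {E' : Type*} [NormedAddCommGroup E'] [NormedSpace ℝ E']
  {N : Type*} [TopologicalSpace N] [ChartedSpace E' N] [IsManifold 𝓘(ℝ, E') ∞ N]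

theorem related_id (D : LinearConnection E M) : Related id D D := by
  intro w
  rw [tangentMap_id, tangentMap_id]
  rfl

/-- By functoriality `TTg` inverts `TTh`, so the relation at `TTh w` computes `K_N w`; applying `Th`
to it gives the claim. -/
theorem Related.symm {DM : LinearConnection E M} {DN : LinearConnection E' N}
    {g : M → N} {h : N → M} (hg : ContMDiff 𝓘(ℝ, E) 𝓘(ℝ, E') ∞ g)
    (hh : ContMDiff 𝓘(ℝ, E') 𝓘(ℝ, E) ∞ h) (hgh : Function.LeftInverse h g)
    (hhg : Function.LeftInverse g h) (hR : Related g DM DN) : Related h DN DM := by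
  have hgd : MDifferentiable 𝓘(ℝ, E) 𝓘(ℝ, E') g := hg.mdifferentiable (by simp)
  have hhd : MDifferentiable 𝓘(ℝ, E') 𝓘(ℝ, E) h := hh.mdifferentiable (by simp)
  have hTg : MDifferentiable 𝓘(ℝ, E).tangent 𝓘(ℝ, E').tangent (tangentMap 𝓘(ℝ, E) 𝓘(ℝ, E') g) :=
    (hg.contMDiff_tangentMap (m := ∞) (by simp)).mdifferentiable (by simp)
  have hTh : MDifferentiable 𝓘(ℝ, E').tangent 𝓘(ℝ, E).tangent (tangentMap 𝓘(ℝ, E') 𝓘(ℝ, E) h) :=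
    (hh.contMDiff_tangentMap (m := ∞) (by simp)).mdifferentiable (by simp)
  have e1 : tangentMap 𝓘(ℝ, E') 𝓘(ℝ, E) h ∘ tangentMap 𝓘(ℝ, E) 𝓘(ℝ, E') g = id := by
    rw [← tangentMap_comp hhd hgd, hgh.comp_eq_id, tangentMap_id]
  have e2 : tangentMap 𝓘(ℝ, E) 𝓘(ℝ, E') g ∘ tangentMap 𝓘(ℝ, E') 𝓘(ℝ, E) h = id := by
    rw [← tangentMap_comp hgd hhd, hhg.comp_eq_id, tangentMap_id]
  intro w
  have e3 : tangentMap 𝓘(ℝ, E).tangent 𝓘(ℝ, E').tangent (tangentMap 𝓘(ℝ, E) 𝓘(ℝ, E') g)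
      (tangentMap 𝓘(ℝ, E').tangent 𝓘(ℝ, E).tangent (tangentMap 𝓘(ℝ, E') 𝓘(ℝ, E) h) w) = w := by
    rw [← tangentMap_comp_at w (hTg _) (hTh _), e2, tangentMap_id]
    rfl
  have key := hR (tangentMap 𝓘(ℝ, E').tangent 𝓘(ℝ, E).tangent (tangentMap 𝓘(ℝ, E') 𝓘(ℝ, E) h) w)
  rw [e3] at key
  rw [key]
  exact (congrFun e1 _).symm

end Related

/-! ### Bundle structures and the isomorphism. -/

section Bundles

variable {E : Type*} [NormedAddCommGroup E] [NormedSpace ℝ E]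
  {M : Type*} [TopologicalSpace M] [ChartedSpace E M]
  {E' : Type*} [NormedAddCommGroup E'] [NormedSpace ℝ E']
  {N : Type*} [TopologicalSpace N] [ChartedSpace E' N]

theorem fderiv_localRep_leftInverse {g : M → N} {h : N → M}
    (hg : ContMDiff 𝓘(ℝ, E) 𝓘(ℝ, E') ∞ g) (hh : ContMDiff 𝓘(ℝ, E') 𝓘(ℝ, E) ∞ h)
    (hgh : Function.LeftInverse h g)
    {φ : OpenPartialHomeomorph M E} (hφ : φ ∈ IsManifold.maximalAtlas 𝓘(ℝ, E) ∞ M)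
    {ψ : OpenPartialHomeomorph N E'} (hψ : ψ ∈ IsManifold.maximalAtlas 𝓘(ℝ, E') ∞ N)
    {x : E} (hx : x ∈ localDom φ ψ g) (v : E) :
    fderiv ℝ (localRep ψ φ h) (localRep φ ψ g x) (fderiv ℝ (localRep φ ψ g) x v) = v := by
  have hy : localRep φ ψ g x ∈ localDom ψ φ h := by
    have hx' := mem_localDom.1 hx
    rw [mem_localDom]
    refine ⟨ψ.map_source hx'.2, ?_⟩
    rw [localRep, ψ.left_inv hx'.2, hgh]
    exact φ.map_target hx'.1
  have h1 := (contDiffAt_localRep hφ hψ hg hx).differentiableAt (by simp)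
  have h2 := (contDiffAt_localRep hψ hφ hh hy).differentiableAt (by simp)
  have he : localRep ψ φ h ∘ localRep φ ψ g =ᶠ[𝓝 x] id := by
    filter_upwards [(isOpen_localDom hg.continuous).mem_nhds hx] with z hz
    have hz' := mem_localDom.1 hz
    simp [localRep, ψ.left_inv hz'.2, hgh _, φ.right_inv hz'.1]
  have h3 := fderiv_comp x h2 h1
  rw [he.fderiv_eq, fderiv_id] at h3
  exact (congrArg (fun L : E →L[ℝ] E => L v) h3).symm

variable [IsManifold 𝓘(ℝ, E) ∞ M] [IsManifold 𝓘(ℝ, E') ∞ N]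

theorem isVectorBundleMorphism_oscMap (k : ℕ) {DM : LinearConnection E M}
    {DN : LinearConnection E' N} {g : M → N} (hg : ContMDiff 𝓘(ℝ, E) 𝓘(ℝ, E') ∞ g)
    (hR : Related g DM DN) :
    IsVectorBundleMorphism (oscProj E k) (oscTriv DM k) (oscProj E' k) (oscTriv DN k)
      (oscMap k g hg) g where
  smooth_base := hg
  proj_comp _ := rfl
  local_form φ hφ ψ hψ :=
    ⟨fun x => diagMap k (fderiv ℝ (localRep φ ψ g) x),
      fun _ hx => (contDiffAt_diagMap k ((contDiffAt_localRep hφ hψ hg hx).fderiv_right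
        (m := ∞) (by simp))).contDiffWithinAt,
      fun _ hp => oscTriv_oscMap hg hR hφ hψ hp.1 hp.2⟩

theorem isVectorBundleIso_oscMap (k : ℕ) {DM : LinearConnection E M}
    {DN : LinearConnection E' N} (g : Diffeomorph 𝓘(ℝ, E) 𝓘(ℝ, E') M N ∞)
    (hR : Related g DM DN) :
    IsVectorBundleIso (oscProj E k) (oscTriv DM k) (oscProj E' k) (oscTriv DN k)
      (oscMap k g g.contMDiff) g :=
  ⟨isVectorBundleMorphism_oscMap k g.contMDiff hR,
    oscMap k g.symm g.symm.contMDiff, g.symm,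
    isVectorBundleMorphism_oscMap k g.symm.contMDiff
      (hR.symm g.contMDiff g.symm.contMDiff g.symm_apply_apply g.apply_symm_apply),
    oscMap_leftInverse g.contMDiff g.symm.contMDiff g.symm_apply_apply,
    oscMap_leftInverse g.symm.contMDiff g.contMDiff g.apply_symm_apply,
    g.symm_apply_apply, g.apply_symm_apply⟩

/-- Triangularity recovers the `k`-jet in the chart `φ`. Since equivalence of curves refers to all
charts, `jet_comp` then carries equality of jets to any other chart. -/
theorem injOn_oscTriv (k : ℕ) (D : LinearConnection E M) {φ : OpenPartialHomeomorph M E}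
    (hφ : φ ∈ IsManifold.maximalAtlas 𝓘(ℝ, E) ∞ M) :
    InjOn (oscTriv D k φ) (oscProj E k ⁻¹' φ.source) := by
  intro p hp q hq h
  have hx : p.1 = q.1 := φ.injOn hp hq (congrArg Prod.fst h)
  obtain ⟨x, a⟩ := p
  obtain ⟨x', b⟩ := q
  obtain rfl : x = x' := hx
  replace hp : x ∈ φ.source := hp
  induction a using Quotient.inductionOn with | _ γ => ?_
  induction b using Quotient.inductionOn with | _ δ => ?_
  have hjet : jetCurve k (fun t => φ (γ.toFun t)) 0 = jetCurve k (fun t => φ (δ.toFun t)) 0 := by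
    refine eq_of_zComp_eq (D.christoffel φ) ?_ fun i h1 hi => ?_
    · rw [entry_jetCurve_zero, entry_jetCurve_zero, γ.map_zero, δ.map_zero]
    · have h2 := congrFun (congrArg Prod.snd h) ⟨i - 1, by omega⟩
      have e : i - 1 + 1 = i := by omega
      simp only [oscTriv, e] at h2
      exact ((congrArg (fun u => zComp (D.christoffel φ) u i) (jetCoord_oscMk hφ hp γ)).symm.trans
        h2).trans (congrArg (fun u => zComp (D.christoffel φ) u i) (jetCoord_oscMk hφ hp δ))
  refine congrArg (Sigma.mk x) (Quotient.sound ?_)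
  intro ψ hψ hxψ j _ hj
  have hdom : φ x ∈ localDom φ ψ (id : M → M) := ⟨x, ⟨hp, hxψ⟩, rfl⟩
  have hev : ∀ c : CurveAt E x, (fun t => ψ (c.toFun t)) =ᶠ[𝓝 0]
      localRep φ ψ id ∘ fun t => φ (c.toFun t) := by
    intro c
    obtain ⟨ε, hε, hc⟩ := c.smooth
    have hcont : ContinuousAt c.toFun 0 :=
      (hc.contMDiffAt (Ioo_mem_nhds (by linarith) hε)).continuousAt
    have : ∀ᶠ t in 𝓝 (0 : ℝ), c.toFun t ∈ φ.source :=
      hcont.eventually (φ.open_source.mem_nhds (by rw [c.map_zero]; exact hp))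
    filter_upwards [this] with t ht
    simp [localRep, φ.left_inv ht]
  rw [(hev γ).iteratedDeriv_eq, (hev δ).iteratedDeriv_eq]
  exact jet_comp k _ _ _ (by
      rw [γ.map_zero]; exact contDiffAt_localRep hφ hψ contMDiff_id hdom)
    (chart_curve_contDiffAt γ hφ hp) (chart_curve_contDiffAt δ hφ hp)
    (fun i hi => iteratedDeriv_eq_of_jetCurve_eq hjet hi) j hj

theorem surjOn_oscTriv (k : ℕ) (D : LinearConnection E M) {φ : OpenPartialHomeomorph M E}
    (hφ : φ ∈ IsManifold.maximalAtlas 𝓘(ℝ, E) ∞ M) :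
    SurjOn (oscTriv D k φ) (oscProj E k ⁻¹' φ.source) (φ.target ×ˢ univ) := by
  rintro ⟨x, z⟩ ⟨hx, -⟩
  replace hx : x ∈ φ.target := hx
  -- The components `z^1, …, z^k` are indexed by `Fin k` from zero, hence the shift by one; the
  -- default `0` is never reached for indices `1, …, k`.
  obtain ⟨u, hu0, hu⟩ := exists_zComp_eq (k := k) (D.christoffel φ) x
    (fun n => if h : n - 1 < k then z ⟨n - 1, h⟩ else 0) k le_rfl
  obtain ⟨c, hc, hcu⟩ := exists_jetCurve_eq u
  have hc0 : c 0 = x := by rw [← hu0, ← hcu, entry_jetCurve_zero]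
  have hev : ∀ᶠ t in 𝓝 (0 : ℝ), c t ∈ φ.target :=
    hc.continuous.continuousAt.eventually (φ.open_target.mem_nhds (hc0 ▸ hx))
  obtain ⟨ε, hε, hball⟩ := Metric.eventually_nhds_iff_ball.1 hev
  let γ : CurveAt E (φ.symm x) :=
    { toFun := fun t => φ.symm (c t)
      smooth := ⟨ε, hε, (contMDiffOn_symm_of_mem_maximalAtlas hφ).comp
        hc.contMDiff.contMDiffOn fun t ht => hball t (by
          rw [Real.ball_eq_Ioo]; simpa using ht)⟩
      map_zero := by rw [hc0] }
  have hxs : φ.symm x ∈ φ.source := φ.map_target hx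
  have hj : jetCoord k φ (oscMk E k (φ.symm x) γ) = u := by
    rw [jetCoord_oscMk hφ hxs, ← hcu]
    refine jetCurve_congr ?_
    filter_upwards [hev] with t ht using φ.right_inv ht
  refine ⟨oscMk E k (φ.symm x) γ, hxs, Prod.ext (φ.right_inv hx) (funext fun i => ?_)⟩
  simp only [oscTriv]
  rw [hj, hu _ (by omega) (by omega)]
  simp

theorem isVectorBundleStructure_oscTriv (k : ℕ) (D : LinearConnection E M) :
    IsVectorBundleStructure (oscProj E k) (oscTriv D k) where
  base _ _ _ _ := rfl
  bijOn φ hφ := ⟨fun _ hp => ⟨φ.map_source hp, trivial⟩, injOn_oscTriv k D hφ,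
    surjOn_oscTriv k D hφ⟩
  transition φ hφ ψ hψ := by
    classical
    have hinv : ∀ {α β : OpenPartialHomeomorph M E},
        α ∈ IsManifold.maximalAtlas 𝓘(ℝ, E) ∞ M → β ∈ IsManifold.maximalAtlas 𝓘(ℝ, E) ∞ M →
        ∀ {x : E}, x ∈ localDom α β (id : M → M) → ∀ v : Fin k → E,
          diagMap k (fderiv ℝ (localRep β α id) (localRep α β id x))
            (diagMap k (fderiv ℝ (localRep α β id) x) v) = v := by
      intro α β hα hβ x hx v
      funext i
      rw [diagMap_apply, diagMap_apply]
      exact fderiv_localRep_leftInverse contMDiff_id contMDiff_id (fun _ => rfl) hα hβ hx _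
    have hback : ∀ {x : E}, x ∈ localDom φ ψ (id : M → M) →
        localRep φ ψ id x ∈ localDom ψ φ (id : M → M)
          ∧ localRep ψ φ id (localRep φ ψ id x) = x := by
      rintro _ ⟨p, hp, rfl⟩
      have e : localRep φ ψ id (φ p) = ψ p := by simp [localRep, φ.left_inv hp.1]
      have e' : localRep ψ φ id (ψ p) = φ p := by
        simp [localRep, ψ.left_inv (show p ∈ ψ.source from hp.2)]
      rw [e]
      exact ⟨⟨p, ⟨hp.2, hp.1⟩, rfl⟩, e'⟩
    -- The inverse on the overlap comes from the reverse change of charts. Off the overlap the value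
    -- is irrelevant.
    let G : E → (Fin k → E) ≃L[ℝ] (Fin k → E) := fun x =>
      if hx : x ∈ localDom φ ψ (id : M → M) then
        ContinuousLinearEquiv.equivOfInverse (diagMap k (fderiv ℝ (localRep φ ψ id) x))
          (diagMap k (fderiv ℝ (localRep ψ φ id) (localRep φ ψ id x))) (hinv hφ hψ hx)
          (by
            have := hinv hψ hφ (hback hx).1
            rwa [(hback hx).2] at this)
      else ContinuousLinearEquiv.refl ℝ _
    have hG : ∀ x ∈ localDom φ ψ (id : M → M),
        (G x : (Fin k → E) →L[ℝ] (Fin k → E)) = diagMap k (fderiv ℝ (localRep φ ψ id) x) := by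
      intro x hx
      simp only [G, dif_pos hx]
      rfl
    refine ⟨G, ?_, ?_⟩
    · have hs : ContDiffOn ℝ ∞ (fun x => diagMap k (fderiv ℝ (localRep φ ψ id) x))
          (localDom φ ψ (id : M → M)) := fun x hx =>
        (contDiffAt_diagMap k ((contDiffAt_localRep hφ hψ contMDiff_id hx).fderiv_right
          (m := ∞) (by simp))).contDiffWithinAt
      exact hs.congr hG
    · intro p hp
      -- A change of charts is the local form of `T^k id`.
      have h := oscTriv_oscMap contMDiff_id (related_id D) hφ hψ (p := p) hp.1 hp.2
      rw [oscMap_id] at h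
      rw [h]
      exact (congrArg (fun L : (Fin k → E) →L[ℝ] (Fin k → E) => L (oscTriv D k φ p).2)
        (hG (φ p.1) ⟨p.1, hp, rfl⟩)).symm

end Bundles

end HigherOrderTangent

end

theorem mainTheorem3
    {E : Type*} [NormedAddCommGroup E] [NormedSpace ℝ E] [CompleteSpace E]
    {M : Type*} [TopologicalSpace M] [ChartedSpace E M] [IsManifold 𝓘(ℝ, E) ∞ M]
    {E' : Type*} [NormedAddCommGroup E'] [NormedSpace ℝ E'] [CompleteSpace E']
    {N : Type*} [TopologicalSpace N] [ChartedSpace E' N] [IsManifold 𝓘(ℝ, E') ∞ N]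
    (k : ℕ) (hk : 1 ≤ k) :
    (∀ (DM : HigherOrderTangent.LinearConnection E M)
        (DN : HigherOrderTangent.LinearConnection E' N)
        (g : Diffeomorph 𝓘(ℝ, E) 𝓘(ℝ, E') M N ∞),
      HigherOrderTangent.Related g DM DN →
        HigherOrderTangent.IsVectorBundleStructure
          (HigherOrderTangent.oscProj E k) (HigherOrderTangent.oscTriv DM k) ∧
        HigherOrderTangent.IsVectorBundleStructure
          (HigherOrderTangent.oscProj E' k) (HigherOrderTangent.oscTriv DN k) ∧
        HigherOrderTangent.IsVectorBundleIso
          (HigherOrderTangent.oscProj E k) (HigherOrderTangent.oscTriv DM k)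
          (HigherOrderTangent.oscProj E' k) (HigherOrderTangent.oscTriv DN k)
          (HigherOrderTangent.oscMap k g g.contMDiff) g) ∧
    (∀ (D D' : HigherOrderTangent.LinearConnection E M)
        (g : Diffeomorph 𝓘(ℝ, E) 𝓘(ℝ, E) M M ∞),
      HigherOrderTangent.Related g D D' →
        HigherOrderTangent.IsVectorBundleStructure
          (HigherOrderTangent.oscProj E k) (HigherOrderTangent.oscTriv D k) ∧
        HigherOrderTangent.IsVectorBundleStructure
          (HigherOrderTangent.oscProj E k) (HigherOrderTangent.oscTriv D' k) ∧
        ∃ f : HigherOrderTangent.Osc E M k → HigherOrderTangent.Osc E M k,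
          HigherOrderTangent.IsVectorBundleIso
            (HigherOrderTangent.oscProj E k) (HigherOrderTangent.oscTriv D k)
            (HigherOrderTangent.oscProj E k) (HigherOrderTangent.oscTriv D' k) f g) := by
  exact ⟨fun DM DN g hR => ⟨HigherOrderTangent.isVectorBundleStructure_oscTriv k DM,
      HigherOrderTangent.isVectorBundleStructure_oscTriv k DN,
      HigherOrderTangent.isVectorBundleIso_oscMap k g hR⟩,
    fun D D' g hR => ⟨HigherOrderTangent.isVectorBundleStructure_oscTriv k D,
      HigherOrderTangent.isVectorBundleStructure_oscTriv k D', _,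
      HigherOrderTangent.isVectorBundleIso_oscMap k g hR⟩⟩
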